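/- Let $d\ge 1$ be an integer, $p\ge 1$ a real number and $r\in(1,2)$. For a probability measure $\mu$ on $\mathbb R^d$ put $H(t)=\mu(\{y\in\mathbb R^d:\max_i|y_i|>t\})$ and, for $X$ with distribution $\mu$, $$\|X\|_{rp,w}^{rp}=\sup_{t>0}t^{rp}H(t).$$ For probability measures $\nu_1,\nu_2$ on $\mathbb R^d$ let $W_p^p(\nu_1,\nu_2)=\inf_{\pi}\int|y-z|_2^p\,\pi(dy,dz)$, where $|\cdot|_2$ is the Euclidean norm and the infimum is over all probability measures $\pi$ on $\mathbb R^d\times\mathbb R^d$ with margins $\nu_1$ and $\nu_2$. There is a constant $C>0$, depending only on $d,p,r$, such that the following holds. Let $X_1,X_2,\dots$ be i.i.d. random variables with values in $\mathbb R^d$ and common distribution $\mu$, with $\|X\|_{rp,w}<\infty$, and let $\mu_n=\frac1n\sum_{k=1}^n\delta_{X_k}$. Then, for every $x>0$: * if $p>d(r-1)/r$ and $1/r\le\alpha\le 1$, $$\limsup_{n\to\infty}\,n^{\alpha r-1}\,\mathbb P\Big(W_p^p(\mu_n,\mu)>\frac{x}{n^{1-\alpha}}\Big)\le C\,\frac{\|X\|_{rp,w}^{rp}}{x^r};$$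 * if $p=d(r-1)/r$ and $1/r<\alpha\le 1$, $$\limsup_{n\to\infty}\,\frac{n^{\alpha r-1}}{(\log n)^{2r}}\,\mathbb P\Big(W_p^p(\mu_n,\mu)>\frac{x}{n^{1-\alpha}}\Big)\le C\,\frac{\|X\|_{rp,w}^{rp}}{x^r};$$ * if $p<d(r-1)/r$ and $(d-p)/d\le\alpha\le 1$, $$\limsup_{n\to\infty}\,n^{(pr-(1-\alpha)rd)/d}\,\mathbb P\Big(W_p^p(\mu_n,\mu)>\frac{x}{n^{1-\alpha}}\Big)\le C\,\frac{\|X\|_{rp,w}^{rp}}{x^r}.$$ -/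

import Mathlib

open MeasureTheory ProbabilityTheory Filter
open scoped ENNReal

/-- The tail `H(t) = μ {y : |y| > t}`, where `|y| = max (|y₁|, …, |y_d|)` is the maximum norm,
that is, the norm of the underlying function `Fin d → ℝ`. -/
noncomputable def tail {d : ℕ} (μ : Measure (EuclideanSpace ℝ (Fin d))) (t : ℝ) : ℝ≥0∞ :=
  μ {y | t < ‖WithLp.ofLp y‖}

/-- The weak moment `‖X‖_{q,w}^q = sup_{t > 0} t ^ q * H(t)` of a random variable with law `μ`,
as an element of `[0, ∞]`. -/
noncomputable def weakMoment {d : ℕ} (q : ℝ) (μ : Measure (EuclideanSpace ℝ (Fin d))) : ℝ≥0∞ :=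
  ⨆ (t : ℝ) (_ : 0 < t), ENNReal.ofReal (t ^ q) * tail μ t

/-- The set `Π(ν₁, ν₂)` of probability measures on the product with margins `ν₁` and `ν₂`. -/
def couplings {d : ℕ} (ν₁ ν₂ : Measure (EuclideanSpace ℝ (Fin d))) :
    Set (Measure (EuclideanSpace ℝ (Fin d) × EuclideanSpace ℝ (Fin d))) :=
  {π | IsProbabilityMeasure π ∧ π.map Prod.fst = ν₁ ∧ π.map Prod.snd = ν₂}

/-- `W_p^p(ν₁, ν₂)`, the `p`-th power of the Wasserstein distance of order `p` for the Euclidean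
norm, as an element of `[0, ∞]`. -/
noncomputable def wassersteinPow {d : ℕ} (p : ℝ)
    (ν₁ ν₂ : Measure (EuclideanSpace ℝ (Fin d))) : ℝ≥0∞ :=
  ⨅ π ∈ couplings ν₁ ν₂, ∫⁻ z, ENNReal.ofReal (‖z.1 - z.2‖ ^ p) ∂π

/-- The empirical measure `μ_n = (1/n) ∑_k δ_{X_k}` of the first `n` terms of the sequence
(indexed from `0`), at the outcome `ω`. It is meant for `n ≥ 1`. -/
noncomputable def empiricalMeasure {Ω : Type*} {d : ℕ} (X : ℕ → Ω → EuclideanSpace ℝ (Fin d))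
    (n : ℕ) (ω : Ω) : Measure (EuclideanSpace ℝ (Fin d)) :=
  (n : ℝ≥0∞)⁻¹ • ∑ k ∈ Finset.range n, Measure.dirac (X k ω)

/-- The deviation probability `P(W_p^p(μ_n, μ) > x / n ^ (1 - α))`. -/
noncomputable def deviationProb {Ω : Type*} [MeasurableSpace Ω] {d : ℕ} (P : Measure Ω)
    (X : ℕ → Ω → EuclideanSpace ℝ (Fin d)) (μ : Measure (EuclideanSpace ℝ (Fin d)))
    (p x α : ℝ) (n : ℕ) : ℝ≥0∞ :=
  P {ω | ENNReal.ofReal (x / (n : ℝ) ^ (1 - α)) < wassersteinPow p (empiricalMeasure X n ω) μ}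

/-! The transport cost is bounded scale by scale. Space is cut into dyadic rings `2 ^ (m - 1) < |x|
≤ 2 ^ m` (with a ball for `m = 0`), and ring `m` into grid cells of side `2 ^ (m - l)` for `l < J`.
Matching as much mass as possible in the finest cells, then the leftovers in ever coarser ones,
gives a coupling whose cost is at most a constant times the sum over `m` and `l < J` of `2 ^ (p (m -
l))` times the total discrepancy of the cells of depth `l` in ring `m`, plus a deterministic
remainder of order `2 ^ (-p J)` (`wassersteinPow_le_discrepancy`, `tsum_cellCost_mul_le`).

For `1 ≤ s ≤ 2`, the discrepancy of a cell `A` has `s`-th moment at most `3 n ^ (1 - s) μ(A)`. Ring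
`m` has about `2 ^ (d l)` cells at depth `l` and, once the tail is normalised to `H(t) ≤ t ^ (-r
p)`, mass of order at most `2 ^ (-r p m)`. Hence the weighted discrepancy of ring `m` has `L ^ s`
norm at most a constant times `levelSum d p s n J * 2 ^ (p (1 - r / s) m)`
(`Lp_ringDiscrepancy_le`). At `s = r` this does not decay in `m`, so the rings are split at `2 ^ (p
m)` near `y v₁` and `y v₂`: Markov's inequality is used with an exponent `s₂ > r` on the low rings,
`r` on the middle ones and `s₁ < r` on the high ones. Each group then yields the factor `y ^ (-r)`
(`exists_deviation_bound_of_tail_le`).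

With `2 ^ (d J)` about `n`, what remains is a geometric sum over levels with ratio `2 ^ (d (s - 1) /
s - p)`. Its behaviour at `s = r` separates the three regimes: bounded, growing, or `J` equal terms.
In the last case about `log n` levels meet about `log n` middle rings, whence `(log n) ^ (2 r)`. A
dilation restores a general weak moment, and `y = x / n ^ (1 - α)` turns the bound, valid for every
`n ≥ 2`, into the claim. -/

/-! ### Greedy matching along nested partitions -/

section Coupling

variable {E I : Type*} [MeasurableSpace E] [MeasurableSpace I]

lemma sum_restrict_preimage_singleton [Countable I] [MeasurableSingletonClass I]
    {φ : E → I} (hφ : Measurable φ) (μ : Measure E) :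
    Measure.sum (fun i => μ.restrict (φ ⁻¹' {i})) = μ := by
  have hm : ∀ i, MeasurableSet (φ ⁻¹' {i}) := fun i => hφ (measurableSet_singleton i)
  have hd : Pairwise (Function.onFun Disjoint fun i => φ ⁻¹' {i}) := by
    intro i j hij
    exact Disjoint.preimage φ (by simpa using hij)
  rw [← Measure.restrict_iUnion hd hm]
  have : (⋃ i, φ ⁻¹' {i}) = Set.univ := by
    ext x; simp
  rw [this, Measure.restrict_univ]

lemma lintegral_comp_eq_tsum [Countable I] [MeasurableSingletonClass I]
    {φ : E → I} (hφ : Measurable φ) (μ : Measure E) (k : I → ℝ≥0∞) :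
    ∫⁻ x, k (φ x) ∂μ = ∑' i, k i * μ (φ ⁻¹' {i}) := by
  have hk : Measurable k := measurable_of_countable k
  rw [← lintegral_map hk hφ, lintegral_countable']
  congr 1; ext i
  rw [Measure.map_apply hφ (measurableSet_singleton i)]

/-- `π` couples parts of `μ` and `ν` inside the cells of `φ`, with cost at most `a`, so that in
each cell at most one of the two measures has mass left. -/
def IsGreedyMatching (φ : E → I) (μ ν : Measure E) (c : E × E → ℝ≥0∞) (a : ℝ≥0∞)
    (π : Measure (E × E)) (μ' ν' : Measure E) : Prop :=
  π.map Prod.fst + μ' = μ ∧ π.map Prod.snd + ν' = ν ∧ (∀ᵐ z ∂π, φ z.1 = φ z.2) ∧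
    (∀ i, μ' (φ ⁻¹' {i}) = μ (φ ⁻¹' {i}) - ν (φ ⁻¹' {i})) ∧
    (∀ i, ν' (φ ⁻¹' {i}) = ν (φ ⁻¹' {i}) - μ (φ ⁻¹' {i})) ∧ ∫⁻ z, c z ∂π ≤ a

lemma one_sub_div_max_mul {a b : ℝ≥0∞} (ha : a ≠ ∞) (hb : b ≠ ∞) :
    (1 - b / max a b) * a = a - b := by
  rcases le_total a b with h | h
  · rw [max_eq_right h, tsub_eq_zero_of_le h]
    rcases eq_or_ne b 0 with hb0 | hb0
    · simp [hb0] at h; simp [h]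
    · rw [ENNReal.div_self hb0 hb]; simp
  · rw [max_eq_left h]
    rcases eq_or_ne a 0 with ha0 | ha0
    · simp [ha0]
    · rw [ENNReal.sub_mul (by intros; exact ha), one_mul, ENNReal.div_mul_cancel ha0 ha]

lemma div_max_le_one (a b : ℝ≥0∞) : b / max a b ≤ 1 :=
  ENNReal.div_le_of_le_mul (by simp)

lemma sum_smul_restrict_preimage [Countable I] [MeasurableSingletonClass I]
    {φ : E → I} (hφ : Measurable φ) (μ : Measure E) (w : I → ℝ≥0∞) (j : I) :
    Measure.sum (fun i => w i • μ.restrict (φ ⁻¹' {i})) (φ ⁻¹' {j}) = w j * μ (φ ⁻¹' {j}) := by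
  have hm : ∀ i, MeasurableSet (φ ⁻¹' {i}) := fun i => hφ (measurableSet_singleton i)
  rw [Measure.sum_apply _ (hm j), tsum_eq_single j]
  · simp [Measure.restrict_apply (hm j)]
  · intro i hij
    have : φ ⁻¹' {j} ∩ φ ⁻¹' {i} = ∅ := by
      ext x; simp only [Set.mem_inter_iff, Set.mem_preimage, Set.mem_singleton_iff,
        Set.mem_empty_iff_false, iff_false]
      rintro ⟨h1, h2⟩; exact hij (h2.symm.trans h1)
    simp [Measure.restrict_apply (hm j), this]

/-- In a cell of masses `a` and `b`, the product of the two restrictions divided by `max a b` has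
total mass `min a b`. Its margins are the fractions `b / max a b` of `μ` and `a / max a b` of `ν`,
so one of the two measures is exhausted. -/
lemma exists_greedyMatching [Countable I] [MeasurableSingletonClass I]
    {φ : E → I} (hφ : Measurable φ) (μ ν : Measure E) [IsFiniteMeasure μ] [IsFiniteMeasure ν]
    (c : E × E → ℝ≥0∞) :
    ∃ π μ' ν', IsGreedyMatching φ μ ν c (∫⁻ z, c z ∂π) π μ' ν' := by
  have hm : ∀ i, MeasurableSet (φ ⁻¹' {i}) := fun i => hφ (measurableSet_singleton i)
  set a : I → ℝ≥0∞ := fun i => μ (φ ⁻¹' {i}) with ha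
  set b : I → ℝ≥0∞ := fun i => ν (φ ⁻¹' {i}) with hb
  have hat : ∀ i, a i ≠ ∞ := fun i => measure_ne_top _ _
  have hbt : ∀ i, b i ≠ ∞ := fun i => measure_ne_top _ _
  refine ⟨Measure.sum fun i => (max (a i) (b i))⁻¹ •
      (μ.restrict (φ ⁻¹' {i})).prod (ν.restrict (φ ⁻¹' {i})),
    Measure.sum fun i => (1 - b i / max (a i) (b i)) • μ.restrict (φ ⁻¹' {i}),
    Measure.sum fun i => (1 - a i / max (a i) (b i)) • ν.restrict (φ ⁻¹' {i}),
    ?_, ?_, ?_, ?_, ?_, le_rfl⟩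
  · rw [Measure.map_sum measurable_fst.aemeasurable, Measure.sum_add_sum]
    conv_rhs => rw [← sum_restrict_preimage_singleton hφ μ]
    congr 1; ext1 i
    rw [Measure.map_smul, Measure.map_fst_prod, Measure.restrict_apply_univ, smul_smul, ← add_smul]
    change ((max (a i) (b i))⁻¹ * b i + _) • _ = _
    rw [mul_comm, ← div_eq_mul_inv, add_tsub_cancel_of_le (div_max_le_one _ _), one_smul]
  · rw [Measure.map_sum measurable_snd.aemeasurable, Measure.sum_add_sum]
    conv_rhs => rw [← sum_restrict_preimage_singleton hφ ν]
    congr 1; ext1 i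
    rw [Measure.map_smul, Measure.map_snd_prod, Measure.restrict_apply_univ, smul_smul, ← add_smul]
    change ((max (a i) (b i))⁻¹ * a i + _) • _ = _
    rw [mul_comm, ← div_eq_mul_inv, max_comm,
      add_tsub_cancel_of_le (div_max_le_one _ _), one_smul]
  · rw [Measure.ae_sum_iff]
    intro i
    refine Measure.ae_smul_measure ?_ _
    rw [Measure.prod_restrict]
    refine (ae_restrict_mem ((hm i).prod (hm i))).mono ?_
    rintro z ⟨h1, h2⟩
    simp only [Set.mem_preimage, Set.mem_singleton_iff] at h1 h2
    rw [h1, h2]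
  · intro j
    rw [sum_smul_restrict_preimage hφ, one_sub_div_max_mul (hat j) (hbt j)]
  · intro j
    rw [sum_smul_restrict_preimage hφ, max_comm, one_sub_div_max_mul (hbt j) (hat j)]

lemma map_fst_preimage_eq_map_snd {φ : E → I} (hφ : Measurable φ) [MeasurableSingletonClass I]
    {π : Measure (E × E)} (h : ∀ᵐ z ∂π, φ z.1 = φ z.2) (i : I) :
    π.map Prod.fst (φ ⁻¹' {i}) = π.map Prod.snd (φ ⁻¹' {i}) := by
  have hm : MeasurableSet (φ ⁻¹' {i}) := hφ (measurableSet_singleton i)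
  rw [Measure.map_apply measurable_fst hm, Measure.map_apply measurable_snd hm]
  refine measure_congr ?_
  filter_upwards [h] with z hz
  apply propext
  change φ z.1 = i ↔ φ z.2 = i
  rw [hz]

/-- The leftovers of the fine matching are matched greedily in the coarse cells. Only they travel,
and in each fine cell they weigh exactly the positive and negative parts of the difference of the
two masses; this gives the added cost. -/
lemma IsGreedyMatching.coarsen [Countable I] [MeasurableSingletonClass I]
    {φ φ' : E → I} (hφ : Measurable φ) (hφ' : Measurable φ')
    (hnest : ∀ x y, φ' x = φ' y → φ x = φ y)
    {μ ν : Measure E} [IsFiniteMeasure μ] [IsFiniteMeasure ν] {c : E × E → ℝ≥0∞} {a : ℝ≥0∞}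
    (k : I → ℝ≥0∞) (hc : ∀ x y, φ x = φ y → c (x, y) ≤ k (φ' x) + k (φ' y))
    {π : Measure (E × E)} {μ' ν' : Measure E} (h : IsGreedyMatching φ' μ ν c a π μ' ν') :
    ∃ π₁ μ₁ ν₁, IsGreedyMatching φ μ ν c
      (a + ∑' i, k i * ((μ (φ' ⁻¹' {i}) - ν (φ' ⁻¹' {i})) + (ν (φ' ⁻¹' {i}) - μ (φ' ⁻¹' {i}))))
      π₁ μ₁ ν₁ := by
  obtain ⟨h1, h2, h3, h4, h5, h6⟩ := h
  have hμ' : μ' ≤ μ := by rw [← h1]; exact Measure.le_add_left le_rfl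
  have hν' : ν' ≤ ν := by rw [← h2]; exact Measure.le_add_left le_rfl
  have : IsFiniteMeasure μ' := isFiniteMeasure_of_le μ hμ'
  have : IsFiniteMeasure ν' := isFiniteMeasure_of_le ν hν'
  obtain ⟨π₁, μ₁, ν₁, g1, g2, g3, g4, g5, -⟩ := exists_greedyMatching hφ μ' ν' c
  have h3' : ∀ᵐ z ∂π, φ z.1 = φ z.2 := h3.mono fun z hz => hnest _ _ hz
  have hk : Measurable k := measurable_of_countable k
  -- The fine matching removes equal masses from both measures in each coarse cell, so the coarse
  -- differences are unchanged.
  have hsub : ∀ i, μ' (φ ⁻¹' {i}) - ν' (φ ⁻¹' {i}) = μ (φ ⁻¹' {i}) - ν (φ ⁻¹' {i}) ∧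
      ν' (φ ⁻¹' {i}) - μ' (φ ⁻¹' {i}) = ν (φ ⁻¹' {i}) - μ (φ ⁻¹' {i}) := by
    intro i
    have e := map_fst_preimage_eq_map_snd hφ h3' i
    have hfin : π.map Prod.fst (φ ⁻¹' {i}) ≠ ∞ := by
      refine ne_top_of_le_ne_top (measure_ne_top μ (φ ⁻¹' {i})) ?_
      rw [← h1]; exact le_self_add
    have e1 : μ (φ ⁻¹' {i}) = π.map Prod.fst (φ ⁻¹' {i}) + μ' (φ ⁻¹' {i}) := by
      conv_lhs => rw [← h1]
      rfl
    have e2 : ν (φ ⁻¹' {i}) = π.map Prod.fst (φ ⁻¹' {i}) + ν' (φ ⁻¹' {i}) := by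
      conv_lhs => rw [← h2]
      rw [e]; rfl
    rw [e1, e2, ENNReal.add_sub_add_eq_sub_left hfin, ENNReal.add_sub_add_eq_sub_left hfin]
    exact ⟨rfl, rfl⟩
  refine ⟨π + π₁, μ₁, ν₁, ?_, ?_, ?_, ?_, ?_, ?_⟩
  · rw [Measure.map_add _ _ measurable_fst, add_assoc, g1, h1]
  · rw [Measure.map_add _ _ measurable_snd, add_assoc, g2, h2]
  · exact ae_add_measure_iff.2 ⟨h3', g3⟩
  · intro i; rw [g4, (hsub i).1]
  · intro i; rw [g5, (hsub i).2]
  · rw [lintegral_add_measure]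
    refine add_le_add h6 ?_
    calc ∫⁻ z, c z ∂π₁ ≤ ∫⁻ z, (k (φ' z.1) + k (φ' z.2)) ∂π₁ :=
          lintegral_mono_ae (g3.mono fun z hz => hc _ _ hz)
      _ = ∫⁻ x, k (φ' x) ∂(π₁.map Prod.fst) + ∫⁻ x, k (φ' x) ∂(π₁.map Prod.snd) := by
          rw [lintegral_add_left (by fun_prop), lintegral_map (by fun_prop) measurable_fst,
            lintegral_map (by fun_prop) measurable_snd]
      _ ≤ ∫⁻ x, k (φ' x) ∂μ' + ∫⁻ x, k (φ' x) ∂ν' := by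
          gcongr
          · rw [← g1]; exact Measure.le_add_right le_rfl
          · rw [← g2]; exact Measure.le_add_right le_rfl
      _ = _ := by
          rw [lintegral_comp_eq_tsum hφ', lintegral_comp_eq_tsum hφ', ← ENNReal.tsum_add]
          congr 1; ext i
          rw [h4, h5, mul_add]

lemma exists_greedyMatching_root [Countable I] [MeasurableSingletonClass I]
    {ψ : ℕ → E → I} (hψ : ∀ l, Measurable (ψ l))
    (hnest : ∀ l x y, ψ (l + 1) x = ψ (l + 1) y → ψ l x = ψ l y)
    {μ ν : Measure E} [IsFiniteMeasure μ] [IsFiniteMeasure ν] {c : E × E → ℝ≥0∞}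
    (k : ℕ → I → ℝ≥0∞)
    (hc : ∀ l x y, ψ l x = ψ l y → c (x, y) ≤ k l (ψ (l + 1) x) + k l (ψ (l + 1) y))
    (J : ℕ) (a : ℝ≥0∞) (π : Measure (E × E)) (μ' ν' : Measure E)
    (h : IsGreedyMatching (ψ J) μ ν c a π μ' ν') :
    ∃ π₁ μ₁ ν₁, IsGreedyMatching (ψ 0) μ ν c
      (a + ∑ l ∈ Finset.range J, ∑' i, k l i * ((μ (ψ (l + 1) ⁻¹' {i}) - ν (ψ (l + 1) ⁻¹' {i}))
        + (ν (ψ (l + 1) ⁻¹' {i}) - μ (ψ (l + 1) ⁻¹' {i})))) π₁ μ₁ ν₁ := by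
  induction J generalizing a π μ' ν' with
  | zero => exact ⟨π, μ', ν', by simpa using h⟩
  | succ J ih =>
    obtain ⟨π₁, μ₁, ν₁, h₁⟩ := h.coarsen (hψ J) (hψ (J + 1)) (hnest J) (k J) (hc J)
    obtain ⟨π₂, μ₂, ν₂, h₂⟩ := ih _ _ _ _ h₁
    refine ⟨π₂, μ₂, ν₂, ?_⟩
    rw [Finset.sum_range_succ, add_comm (Finset.sum _ _), ← add_assoc]
    exact h₂

end Coupling

/-- At the root there is a single cell, in which both measures have mass one. Nothing is left over
there, and the matching is a coupling. The finest matching is paid by its second margin, which is at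
most `ν`. -/
lemma wassersteinPow_le_of_multiscale {d : ℕ} {p : ℝ} {I : Type*} [MeasurableSpace I]
    [Countable I] [MeasurableSingletonClass I]
    {ψ : ℕ → EuclideanSpace ℝ (Fin d) → I} (hψ : ∀ l, Measurable (ψ l))
    (hroot : ∀ x y, ψ 0 x = ψ 0 y)
    (hnest : ∀ l x y, ψ (l + 1) x = ψ (l + 1) y → ψ l x = ψ l y)
    (μ ν : Measure (EuclideanSpace ℝ (Fin d))) [IsProbabilityMeasure μ] [IsProbabilityMeasure ν]
    (k : ℕ → I → ℝ≥0∞)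
    (hc : ∀ l x y, ψ l x = ψ l y →
      ENNReal.ofReal (‖x - y‖ ^ p) ≤ k l (ψ (l + 1) x) + k l (ψ (l + 1) y))
    (J : ℕ) (κ : EuclideanSpace ℝ (Fin d) → ℝ≥0∞) (hκ : Measurable κ)
    (hκc : ∀ x y, ψ J x = ψ J y → ENNReal.ofReal (‖x - y‖ ^ p) ≤ κ y) :
    wassersteinPow p μ ν ≤
      ∑ l ∈ Finset.range J, ∑' i, k l i * ((μ (ψ (l + 1) ⁻¹' {i}) - ν (ψ (l + 1) ⁻¹' {i}))
        + (ν (ψ (l + 1) ⁻¹' {i}) - μ (ψ (l + 1) ⁻¹' {i}))) + ∫⁻ x, κ x ∂ν := by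
  set c : EuclideanSpace ℝ (Fin d) × EuclideanSpace ℝ (Fin d) → ℝ≥0∞ :=
    fun z => ENNReal.ofReal (‖z.1 - z.2‖ ^ p)
  obtain ⟨π₀, μ₀, ν₀, h₀⟩ := exists_greedyMatching (hψ J) μ ν c
  have hcost : ∫⁻ z, c z ∂π₀ ≤ ∫⁻ x, κ x ∂ν := by
    calc ∫⁻ z, c z ∂π₀ ≤ ∫⁻ z, κ z.2 ∂π₀ :=
          lintegral_mono_ae (h₀.2.2.1.mono fun z hz => hκc _ _ hz)
      _ = ∫⁻ x, κ x ∂(π₀.map Prod.snd) := (lintegral_map hκ measurable_snd).symm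
      _ ≤ _ := by
          gcongr
          conv_rhs => rw [← h₀.2.1]
          exact Measure.le_add_right le_rfl
  obtain ⟨π, μ', ν', h1, h2, -, h4, h5, h6⟩ :=
    exists_greedyMatching_root hψ hnest k hc J _ π₀ μ₀ ν₀ h₀
  obtain ⟨x₀⟩ : Nonempty (EuclideanSpace ℝ (Fin d)) := inferInstance
  have huniv : ψ 0 ⁻¹' {ψ 0 x₀} = Set.univ := by
    ext x; simpa using hroot x x₀
  have hμ' : μ' = 0 := by
    have := h4 (ψ 0 x₀)
    rw [huniv, measure_univ (μ := μ), measure_univ (μ := ν), tsub_self] at this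
    exact Measure.measure_univ_eq_zero.1 this
  have hν' : ν' = 0 := by
    have := h5 (ψ 0 x₀)
    rw [huniv, measure_univ (μ := μ), measure_univ (μ := ν), tsub_self] at this
    exact Measure.measure_univ_eq_zero.1 this
  rw [hμ', add_zero] at h1
  rw [hν', add_zero] at h2
  have hπ : IsProbabilityMeasure π := by
    constructor
    have := congrArg (fun m => m Set.univ) h1
    simpa [Measure.map_apply measurable_fst MeasurableSet.univ] using this
  refine (iInf₂_le π ⟨hπ, h1, h2⟩).trans (h6.trans ?_)
  rw [add_comm]
  gcongr

/-- Symmetric truncated difference `|a - b|` of extended nonnegative reals. -/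
noncomputable def absDiff (a b : ℝ≥0∞) : ℝ≥0∞ := (a - b) + (b - a)

/-! ### Dyadic rings, their grids and the cost of a cell -/

section Cells

variable {d : ℕ}

/-- The index of the dyadic ring `{2 ^ (m - 1) < |x| ≤ 2 ^ m}` (`{|x| ≤ 1}` for `m = 0`)
containing `x`. -/
noncomputable def ringIndex (x : EuclideanSpace ℝ (Fin d)) : ℕ :=
  Nat.clog 2 ⌈‖WithLp.ofLp x‖⌉₊

/-- The grid index of `x` at scale `2 ^ (m - l)`, where `m` is the ring index of `x`. -/
noncomputable def gridIndex (l : ℕ) (x : EuclideanSpace ℝ (Fin d)) : ℕ × (Fin d → ℤ) :=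
  (ringIndex x, fun i => ⌊(2 : ℝ) ^ l / 2 ^ ringIndex x * x i⌋)

/-- The nested partitions: the trivial one, followed by the grids at scales `2 ^ (m - l)`. -/
noncomputable def cellIndex : ℕ → EuclideanSpace ℝ (Fin d) → ℕ × (Fin d → ℤ)
  | 0, _ => (0, 0)
  | l + 1, x => gridIndex l x

/-- Grid indices met by a ring at depth `l`. -/
noncomputable def gridBox (d l : ℕ) : Finset (Fin d → ℤ) :=
  Fintype.piFinset fun _ => Finset.Icc (-2 ^ l) (2 ^ l)

lemma card_gridBox_le (d l : ℕ) : ((gridBox d l).card : ℝ) ≤ 3 ^ d * (2 ^ l) ^ d := by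
  have h : (gridBox d l).card = (2 * 2 ^ l + 1) ^ d := by
    rw [gridBox, Fintype.card_piFinset]
    simp only [Int.card_Icc, Finset.prod_const, Finset.card_univ, Fintype.card_fin]
    congr 1
    have : (2 ^ l + 1 - -2 ^ l : ℤ) = ((2 * 2 ^ l + 1 : ℕ) : ℤ) := by push_cast; ring
    rw [this, Int.toNat_natCast]
  rw [h, ← mul_pow]
  push_cast
  have : (1 : ℝ) ≤ 2 ^ l := one_le_pow₀ (by norm_num)
  gcongr
  linarith

lemma ringIndex_le_iff (x : EuclideanSpace ℝ (Fin d)) (m : ℕ) :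
    ringIndex x ≤ m ↔ ‖WithLp.ofLp x‖ ≤ 2 ^ m := by
  rw [ringIndex, Nat.clog_le_iff_le_pow (by norm_num), Nat.ceil_le]
  push_cast; rfl

lemma norm_ofLp_le (x : EuclideanSpace ℝ (Fin d)) : ‖WithLp.ofLp x‖ ≤ 2 ^ ringIndex x :=
  (ringIndex_le_iff x _).1 le_rfl

lemma measurable_ringIndex : Measurable (ringIndex (d := d)) := by
  unfold ringIndex
  exact (measurable_from_top (f := Nat.clog 2)).comp
    (Nat.measurable_ceil.comp (by fun_prop))

lemma measurable_gridIndex (l : ℕ) : Measurable (gridIndex (d := d) l) := by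
  unfold gridIndex
  refine measurable_ringIndex.prodMk (measurable_pi_lambda _ fun i => ?_)
  refine Int.measurable_floor.comp (Measurable.mul ?_ (by fun_prop))
  exact (measurable_from_top (f := fun m : ℕ => (2 : ℝ) ^ l / 2 ^ m)).comp measurable_ringIndex

lemma measurable_cellIndex (l : ℕ) : Measurable (cellIndex (d := d) l) := by
  cases l with
  | zero => exact measurable_const
  | succ l => exact measurable_gridIndex l

lemma floor_eq_of_floor_two_mul_eq {a b : ℝ} (h : ⌊2 * a⌋ = ⌊2 * b⌋) : ⌊a⌋ = ⌊b⌋ := by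
  have key : ∀ a b : ℝ, ⌊2 * a⌋ = ⌊2 * b⌋ → ⌊a⌋ ≤ ⌊b⌋ := by
    intro a b h
    rw [Int.le_floor]
    have h1 : 2 * ⌊a⌋ ≤ ⌊2 * a⌋ := by
      rw [Int.le_floor]; push_cast; linarith [Int.floor_le a]
    rw [h, Int.le_floor] at h1
    push_cast at h1; linarith
  exact le_antisymm (key a b h) (key b a h.symm)

lemma cellIndex_nested (l : ℕ) (x y : EuclideanSpace ℝ (Fin d))
    (h : cellIndex (l + 1) x = cellIndex (l + 1) y) : cellIndex l x = cellIndex l y := by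
  cases l with
  | zero => rfl
  | succ l =>
    simp only [cellIndex, gridIndex, Prod.mk.injEq] at h ⊢
    refine ⟨h.1, funext fun i => ?_⟩
    have := congrFun h.2 i
    apply floor_eq_of_floor_two_mul_eq
    rw [← mul_assoc, ← mul_assoc]
    convert this using 3 <;> ring

lemma euclidean_norm_le {v : EuclideanSpace ℝ (Fin d)} {b : ℝ} (hb : 0 ≤ b)
    (h : ∀ i, |v i| ≤ b) : ‖v‖ ≤ √d * b := by
  rw [EuclideanSpace.norm_eq]
  apply Real.sqrt_le_iff.2 ⟨by positivity, ?_⟩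
  rw [mul_pow, Real.sq_sqrt (by positivity)]
  calc ∑ i, ‖v i‖ ^ 2 ≤ ∑ _i : Fin d, b ^ 2 := by
        gcongr with i; exact h i
    _ = d * b ^ 2 := by simp

lemma abs_coord_le (x : EuclideanSpace ℝ (Fin d)) (i : Fin d) : |x i| ≤ 2 ^ ringIndex x :=
  (norm_le_pi_norm (WithLp.ofLp x) i).trans (norm_ofLp_le x)

lemma norm_sub_le_of_gridIndex_eq {l : ℕ} {x y : EuclideanSpace ℝ (Fin d)}
    (h : gridIndex l x = gridIndex l y) : ‖x - y‖ ≤ √d * (2 ^ ringIndex y / 2 ^ l) := by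
  refine euclidean_norm_le (by positivity) fun i => ?_
  simp only [gridIndex, Prod.mk.injEq] at h
  have h2 := congrFun h.2 i
  rw [h.1] at h2
  have h3 := Int.abs_sub_lt_one_of_floor_eq_floor h2
  rw [← mul_sub, abs_mul, abs_of_pos (by positivity)] at h3
  simp only [PiLp.sub_apply]
  rw [le_div_iff₀ (by positivity)]
  rw [div_mul_eq_mul_div, div_lt_one (by positivity)] at h3
  linarith

/-- The cost `2 ^ (p (m - l))` of moving a unit mass inside a cell of depth `l` in ring `m`. -/
noncomputable def cellCost (p : ℝ) (m l : ℕ) : ℝ≥0∞ :=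
  ENNReal.ofReal ((2 : ℝ) ^ (p * m - p * l))

lemma rpow_cellCost {p : ℝ} (m l : ℕ) :
    ((2 : ℝ) ^ m / 2 ^ l) ^ p = (2 : ℝ) ^ (p * m - p * l) := by
  rw [← Real.rpow_natCast, ← Real.rpow_natCast, ← Real.rpow_sub (by norm_num),
    ← Real.rpow_mul (by norm_num)]
  congr 1; ring

/-- The factor `2` serves twice: a cell of `cellIndex (l + 1)` has side `2 ^ (m - l)`, twice `2 ^ (m
- (l + 1))`, and at the root the triangle inequality adds the norms of two points. -/
lemma cost_le_of_norm_le {p : ℝ} (hp : 1 ≤ p) {x y : EuclideanSpace ℝ (Fin d)} {m l : ℕ}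
    (h : ‖x - y‖ ≤ 2 * √d * (2 ^ m / 2 ^ l)) :
    ENNReal.ofReal (‖x - y‖ ^ p) ≤ ENNReal.ofReal ((2 * √d) ^ p) * cellCost p m l := by
  rw [cellCost, ← ENNReal.ofReal_mul (by positivity), ← rpow_cellCost,
    ← Real.mul_rpow (by positivity) (by positivity)]
  gcongr

lemma cost_le_of_cellIndex_succ_eq {p : ℝ} (hp : 1 ≤ p) {l : ℕ}
    {x y : EuclideanSpace ℝ (Fin d)} (h : cellIndex (l + 1) x = cellIndex (l + 1) y) :
    ENNReal.ofReal (‖x - y‖ ^ p) ≤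
      ENNReal.ofReal ((2 * √d) ^ p) * cellCost p (ringIndex y) (l + 1) := by
  apply cost_le_of_norm_le hp
  refine (norm_sub_le_of_gridIndex_eq (l := l) h).trans (le_of_eq ?_)
  rw [pow_succ]; field_simp

/-- Below the root both points share a ring and one term suffices. At the root the rings may differ,
and the outer one pays. -/
lemma cost_le_of_cellIndex_eq {p : ℝ} (hp : 1 ≤ p) (l : ℕ)
    (x y : EuclideanSpace ℝ (Fin d)) (h : cellIndex l x = cellIndex l y) :
    ENNReal.ofReal (‖x - y‖ ^ p) ≤
      ENNReal.ofReal ((2 * √d) ^ p) * cellCost p (ringIndex x) l +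
      ENNReal.ofReal ((2 * √d) ^ p) * cellCost p (ringIndex y) l := by
  cases l with
  | succ l => exact (cost_le_of_cellIndex_succ_eq hp h).trans le_add_self
  | zero =>
    have hx := euclidean_norm_le (by positivity) (abs_coord_le x)
    have hy := euclidean_norm_le (by positivity) (abs_coord_le y)
    have hxy := norm_sub_le x y
    rcases le_total (ringIndex x) (ringIndex y) with hle | hle
    · refine le_trans (cost_le_of_norm_le hp ?_) le_add_self
      have : (2 : ℝ) ^ ringIndex x ≤ 2 ^ ringIndex y := pow_le_pow_right₀ (by norm_num) hle
      have := mul_le_mul_of_nonneg_left this (Real.sqrt_nonneg d)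
      simp only [pow_zero, div_one]; linarith
    · refine le_trans (cost_le_of_norm_le hp ?_) le_self_add
      have : (2 : ℝ) ^ ringIndex y ≤ 2 ^ ringIndex x := pow_le_pow_right₀ (by norm_num) hle
      have := mul_le_mul_of_nonneg_left this (Real.sqrt_nonneg d)
      simp only [pow_zero, div_one]; linarith

/-- Total discrepancy of `μ` and `ν` over the cells of depth `l` in ring `m`. -/
noncomputable def discrepancy (μ ν : Measure (EuclideanSpace ℝ (Fin d))) (m l : ℕ) : ℝ≥0∞ :=
  ∑ f ∈ gridBox d l, absDiff (μ (gridIndex l ⁻¹' {(m, f)})) (ν (gridIndex l ⁻¹' {(m, f)}))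

lemma gridIndex_mem_gridBox (l : ℕ) (x : EuclideanSpace ℝ (Fin d)) :
    (gridIndex l x).2 ∈ gridBox d l := by
  simp only [gridBox, gridIndex, Fintype.mem_piFinset, Finset.mem_Icc]
  intro i
  have h := abs_le.1 (abs_coord_le x i)
  have h1 : (2 : ℝ) ^ l / 2 ^ ringIndex x * 2 ^ ringIndex x = 2 ^ l := by field_simp
  have h0 : (0 : ℝ) ≤ 2 ^ l / 2 ^ ringIndex x := by positivity
  constructor
  · rw [Int.le_floor]; push_cast
    nlinarith [mul_le_mul_of_nonneg_left h.1 h0]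
  · rw [← Int.lt_add_one_iff, Int.floor_lt]; push_cast
    nlinarith [mul_le_mul_of_nonneg_left h.2 h0]

lemma preimage_gridIndex_eq_empty {l m : ℕ} {f : Fin d → ℤ} (hf : f ∉ gridBox d l) :
    gridIndex l ⁻¹' {(m, f)} = ∅ := by
  ext x
  simp only [Set.mem_preimage, Set.mem_singleton_iff, Set.mem_empty_iff_false, iff_false]
  intro h
  apply hf
  have := gridIndex_mem_gridBox l x
  rwa [h] at this

lemma wassersteinPow_le_discrepancy {p : ℝ} (hp : 1 ≤ p)
    (μ ν : Measure (EuclideanSpace ℝ (Fin d))) [IsProbabilityMeasure μ] [IsProbabilityMeasure ν]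
    {J : ℕ} (hJ : 1 ≤ J) :
    wassersteinPow p μ ν ≤ ENNReal.ofReal ((2 * √d) ^ p) *
      (∑' m, ∑ l ∈ Finset.range J, cellCost p m l * discrepancy μ ν m l) +
      ENNReal.ofReal ((2 * √d) ^ p) * ∑' m, cellCost p m J * ν (ringIndex ⁻¹' {m}) := by
  -- As `J ≥ 1`, the finest partition is a grid, not the trivial partition, and its cells have
  -- bounded diameter.
  obtain ⟨J, rfl⟩ : ∃ k, J = k + 1 := ⟨J - 1, by omega⟩
  set D := ENNReal.ofReal ((2 * √d) ^ p)
  have hmeas : Measurable fun x : EuclideanSpace ℝ (Fin d) => D * cellCost p (ringIndex x) (J + 1) :=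
    (measurable_from_top (f := fun m : ℕ => D * cellCost p m (J + 1))).comp measurable_ringIndex
  refine (wassersteinPow_le_of_multiscale (ψ := cellIndex) measurable_cellIndex (fun _ _ => rfl)
    cellIndex_nested μ ν (fun l i => D * cellCost p i.1 l)
    (fun l x y h => cost_le_of_cellIndex_eq hp l x y h) (J + 1)
    (fun y => D * cellCost p (ringIndex y) (J + 1)) hmeas
    (fun x y h => cost_le_of_cellIndex_succ_eq hp h)).trans ?_
  apply add_le_add
  · rw [Summable.tsum_finsetSum (fun _ _ => ENNReal.summable), Finset.mul_sum]
    refine Finset.sum_le_sum fun l _ => ?_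
    rw [ENNReal.tsum_prod', ← ENNReal.tsum_mul_left]
    refine ENNReal.tsum_le_tsum fun m => ?_
    dsimp only
    rw [discrepancy, ← mul_assoc, ENNReal.tsum_mul_left]
    gcongr
    rw [tsum_eq_sum (s := gridBox d l)]
    · rfl
    · intro f hf
      change absDiff (μ (gridIndex l ⁻¹' _)) (ν (gridIndex l ⁻¹' _)) = 0
      rw [preimage_gridIndex_eq_empty hf]
      simp [absDiff]
  · rw [lintegral_comp_eq_tsum measurable_ringIndex ν (fun m => D * cellCost p m (J + 1)),
      ← ENNReal.tsum_mul_left]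
    simp_rw [mul_assoc]
    rfl

end Cells

/-! ### Moments of the discrepancies -/

lemma absDiff_ofReal {a b : ℝ} (ha : 0 ≤ a) (hb : 0 ≤ b) :
    absDiff (ENNReal.ofReal a) (ENNReal.ofReal b) = ENNReal.ofReal |a - b| := by
  rw [absDiff, ← ENNReal.ofReal_sub _ hb, ← ENNReal.ofReal_sub _ ha]
  rcases le_total a b with h | h
  · rw [ENNReal.ofReal_of_nonpos (sub_nonpos.2 h), zero_add, abs_sub_comm,
      abs_of_nonneg (sub_nonneg.2 h)]
  · rw [ENNReal.ofReal_of_nonpos (sub_nonpos.2 h), add_zero, abs_of_nonneg (sub_nonneg.2 h)]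

lemma measurable_absDiff {Ω : Type*} [MeasurableSpace Ω] {f : Ω → ℝ≥0∞} (hf : Measurable f)
    (b : ℝ≥0∞) : Measurable fun ω => absDiff (f ω) b := by
  unfold absDiff
  exact (hf.sub measurable_const).add (measurable_const.sub hf)

/-- Reduces moments of order `s` to the first and second ones, which for a centred sum of `n`
indicators of `A` are both of order at most `n μ(A)`. -/
lemma abs_rpow_le_add_sq {s z : ℝ} (hs₁ : 1 ≤ s) (hs₂ : s ≤ 2) : |z| ^ s ≤ |z| + z ^ 2 := by
  rcases le_total |z| 1 with h | h
  · have := Real.rpow_le_rpow_of_exponent_ge' (abs_nonneg z) h (by norm_num) hs₁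
    rw [Real.rpow_one] at this
    nlinarith [sq_nonneg z]
  · have := Real.rpow_le_rpow_of_exponent_le h hs₂
    rw [Real.rpow_two, sq_abs] at this
    linarith [abs_nonneg z]

lemma empiricalMeasure_apply {Ω : Type*} {d : ℕ} {X : ℕ → Ω → EuclideanSpace ℝ (Fin d)}
    {n : ℕ} (hn : 1 ≤ n) {A : Set (EuclideanSpace ℝ (Fin d))}
    (hA : MeasurableSet A) (ω : Ω) :
    empiricalMeasure X n ω A = ENNReal.ofReal
      ((∑ k ∈ Finset.range n, A.indicator (fun _ => (1 : ℝ)) (X k ω)) / n) := by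
  have hn' : (0 : ℝ) < n := by exact_mod_cast hn
  rw [empiricalMeasure, Measure.smul_apply, smul_eq_mul, Measure.finsetSum_apply,
    ENNReal.ofReal_div_of_pos hn', ENNReal.ofReal_natCast, mul_comm, ← div_eq_mul_inv,
    ENNReal.ofReal_sum_of_nonneg]
  · congr 1
    refine Finset.sum_congr rfl fun k _ => ?_
    rw [Measure.dirac_apply' _ hA]
    by_cases hx : X k ω ∈ A <;> simp [hx]
  · intro k _
    exact Set.indicator_nonneg (fun _ _ => zero_le_one) _

lemma isProbabilityMeasure_empiricalMeasure {Ω : Type*} {d : ℕ}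
    {X : ℕ → Ω → EuclideanSpace ℝ (Fin d)} {n : ℕ} (hn : 1 ≤ n) (ω : Ω) :
    IsProbabilityMeasure (empiricalMeasure X n ω) := by
  constructor
  rw [empiricalMeasure_apply hn MeasurableSet.univ]
  have hn' : (n : ℝ) ≠ 0 := by exact_mod_cast (by omega : n ≠ 0)
  simp [hn']

section Moments

variable {Ω : Type*} [MeasurableSpace Ω] {P : Measure Ω} [IsProbabilityMeasure P]

/-- Moments of order `s ∈ [1, 2]` of a centred sum of independent Bernoulli variables. -/
lemma lintegral_abs_centered_sum_rpow_le {E : Type*} [MeasurableSpace E] {μ : Measure E}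
    [IsProbabilityMeasure μ] {X : ℕ → Ω → E} (hX : ∀ k, Measurable (X k))
    (hlaw : ∀ k, P.map (X k) = μ) (hind : iIndepFun X P) {A : Set E} (hA : MeasurableSet A)
    {s : ℝ} (hs₁ : 1 ≤ s) (hs₂ : s ≤ 2) (n : ℕ) :
    ∫⁻ ω, ENNReal.ofReal
      (|∑ k ∈ Finset.range n, A.indicator (fun _ => (1 : ℝ)) (X k ω) - n * μ.real A| ^ s) ∂P ≤
      ENNReal.ofReal (3 * n * μ.real A) := by
  set g : E → ℝ := A.indicator (fun _ => (1 : ℝ)) with hg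
  have hgm : Measurable g := measurable_const.indicator hA
  have hg01 : ∀ x, g x ∈ Set.Icc (0 : ℝ) 1 := by
    intro x
    by_cases hx : x ∈ A <;> simp [hg, hx]
  set f : ℕ → Ω → ℝ := fun k => g ∘ X k with hf
  have hfm : ∀ k, Measurable (f k) := fun k => hgm.comp (hX k)
  have hL2 : ∀ k, MemLp (f k) 2 P := fun k =>
    memLp_of_bounded (ae_of_all _ fun ω => hg01 _) (hfm k).aestronglyMeasurable 2
  have ha0 : 0 ≤ μ.real A := measureReal_nonneg
  have hint : ∀ k, Integrable (f k) P := fun k => (hL2 k).integrable (by norm_num)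
  have hmean : ∀ k, ∫ ω, f k ω ∂P = μ.real A := by
    intro k
    have : ∫ ω, f k ω ∂P = ∫ x, g x ∂(P.map (X k)) :=
      (integral_map (hX k).aemeasurable hgm.aestronglyMeasurable).symm
    rw [this, hlaw, hg, integral_indicator hA]; simp
  -- An indicator equals its square, so its second moment is its mean.
  have hvar : ∀ k, Var[f k; P] ≤ μ.real A := by
    intro k
    refine (variance_le_expectation_sq (hfm k).aestronglyMeasurable).trans (le_of_eq ?_)
    rw [← hmean k]
    congr 1; ext ω
    simp only [Pi.pow_apply, hf, Function.comp, hg]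
    by_cases hx : X k ω ∈ A <;> simp [hx]
  have hindf : iIndepFun f P := hind.comp (fun _ => g) (fun _ => hgm)
  set S : Ω → ℝ := ∑ k ∈ Finset.range n, f k with hS
  have hSL2 : MemLp S 2 P := memLp_finsetSum' _ fun k _ => hL2 k
  have hSm : Measurable S := by
    have : S = fun ω => ∑ k ∈ Finset.range n, f k ω := by ext ω; simp [hS]
    rw [this]
    exact Finset.measurable_sum _ fun k _ => hfm k
  have hSmean : ∫ ω, S ω ∂P = n * μ.real A := by
    simp only [hS, Finset.sum_apply]
    rw [integral_finsetSum _ fun k _ => hint k]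
    simp [hmean]
  have hSvar : Var[S; P] ≤ n * μ.real A := by
    rw [hS, IndepFun.variance_sum (fun k _ => hL2 k) (fun i _ j _ hij => hindf.indepFun hij)]
    refine (Finset.sum_le_sum fun k _ => hvar k).trans ?_
    simp
  have h2 : ∫⁻ ω, ENNReal.ofReal ((S ω - n * μ.real A) ^ 2) ∂P ≤ ENNReal.ofReal (n * μ.real A) := by
    rw [← hSmean, ← evariance_eq_lintegral_ofReal, ← ofReal_variance hSL2, hSmean]
    exact ENNReal.ofReal_le_ofReal hSvar
  have hS0 : ∀ ω, 0 ≤ S ω := fun ω => by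
    simp only [hS, Finset.sum_apply]
    exact Finset.sum_nonneg fun k _ => (hg01 _).1
  have h1 : ∫⁻ ω, ENNReal.ofReal |S ω - n * μ.real A| ∂P ≤ ENNReal.ofReal (2 * (n * μ.real A)) := by
    calc ∫⁻ ω, ENNReal.ofReal |S ω - n * μ.real A| ∂P
        ≤ ∫⁻ ω, ENNReal.ofReal (S ω + n * μ.real A) ∂P := by
          refine lintegral_mono fun ω => ENNReal.ofReal_le_ofReal ?_
          have := hS0 ω
          have : 0 ≤ n * μ.real A := by positivity
          rw [abs_le]; constructor <;> linarith
      _ = ENNReal.ofReal (∫ ω, (S ω + n * μ.real A) ∂P) := by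
          rw [ofReal_integral_eq_lintegral_ofReal]
          · exact (hSL2.integrable (by norm_num)).add (integrable_const _)
          · refine ae_of_all _ fun ω => ?_
            have := hS0 ω
            change 0 ≤ S ω + n * μ.real A
            positivity
      _ = _ := by
          rw [integral_add (hSL2.integrable (by norm_num)) (integrable_const _), hSmean, integral_const]
          simp only [probReal_univ, smul_eq_mul]; ring_nf
  calc _ ≤ ∫⁻ ω, (ENNReal.ofReal |S ω - n * μ.real A| +
        ENNReal.ofReal ((S ω - n * μ.real A) ^ 2)) ∂P := by
        refine lintegral_mono fun ω => ?_
        rw [← ENNReal.ofReal_add (abs_nonneg _) (sq_nonneg _)]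
        refine ENNReal.ofReal_le_ofReal ?_
        simp only [hS, Finset.sum_apply]
        exact abs_rpow_le_add_sq hs₁ hs₂
    _ ≤ ENNReal.ofReal (2 * (n * μ.real A)) + ENNReal.ofReal (n * μ.real A) := by
        rw [lintegral_add_left (by fun_prop)]
        exact add_le_add h1 h2
    _ = _ := by
        rw [← ENNReal.ofReal_add (by positivity) (by positivity)]
        congr 1; ring

variable {d : ℕ} {X : ℕ → Ω → EuclideanSpace ℝ (Fin d)}

lemma measurable_empiricalMeasure (hX : ∀ k, Measurable (X k)) {n : ℕ} (hn : 1 ≤ n)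
    {A : Set (EuclideanSpace ℝ (Fin d))} (hA : MeasurableSet A) :
    Measurable fun ω => empiricalMeasure X n ω A := by
  simp_rw [empiricalMeasure_apply hn hA]
  refine ENNReal.measurable_ofReal.comp (Measurable.div_const ?_ _)
  exact Finset.measurable_sum _ fun k _ => (measurable_const.indicator hA).comp (hX k)

lemma lintegral_absDiff_rpow_le {μ : Measure (EuclideanSpace ℝ (Fin d))}
    [IsProbabilityMeasure μ] (hX : ∀ k, Measurable (X k))
    (hlaw : ∀ k, P.map (X k) = μ) (hind : iIndepFun X P)
    {A : Set (EuclideanSpace ℝ (Fin d))} (hA : MeasurableSet A)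
    {s : ℝ} (hs₁ : 1 ≤ s) (hs₂ : s ≤ 2) {n : ℕ} (hn : 1 ≤ n) :
    ∫⁻ ω, absDiff (empiricalMeasure X n ω A) (μ A) ^ s ∂P ≤
      ENNReal.ofReal (3 * (n : ℝ) ^ (1 - s)) * μ A := by
  have hn' : (0 : ℝ) < n := by exact_mod_cast hn
  have e : ∀ ω, absDiff (empiricalMeasure X n ω A) (μ A) ^ s =
      ENNReal.ofReal ((n : ℝ) ^ (-s)) * ENNReal.ofReal
      (|∑ k ∈ Finset.range n, A.indicator (fun _ => (1 : ℝ)) (X k ω) - n * μ.real A| ^ s) := by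
    intro ω
    rw [empiricalMeasure_apply hn hA, ← ofReal_measureReal (μ := μ) (s := A), absDiff_ofReal,
      ENNReal.ofReal_rpow_of_nonneg (abs_nonneg _) (by linarith),
      ← ENNReal.ofReal_mul (by positivity), Real.rpow_neg hn'.le, mul_comm, ← div_eq_mul_inv,
      ← Real.div_rpow (abs_nonneg _) hn'.le]
    · congr 2
      rw [← abs_of_pos hn', ← abs_div, abs_of_pos hn']
      congr 1; field_simp
    · exact div_nonneg (Finset.sum_nonneg fun k _ =>
        Set.indicator_nonneg (fun _ _ => zero_le_one) _) hn'.le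
    · exact measureReal_nonneg
  simp_rw [e]
  rw [lintegral_const_mul' _ _ ENNReal.ofReal_ne_top]
  refine (mul_le_mul_right (lintegral_abs_centered_sum_rpow_le hX hlaw hind hA hs₁ hs₂ n)
    _).trans (le_of_eq ?_)
  conv_rhs => rw [← ofReal_measureReal (μ := μ) (s := A)]
  rw [← ENNReal.ofReal_mul (by positivity), ← ENNReal.ofReal_mul (by positivity)]
  congr 1
  rw [sub_eq_add_neg, Real.rpow_add hn', Real.rpow_one]; ring

lemma measurable_discrepancy (hX : ∀ k, Measurable (X k)) {n : ℕ} (hn : 1 ≤ n)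
    (μ : Measure (EuclideanSpace ℝ (Fin d))) (m l : ℕ) :
    Measurable fun ω => discrepancy (empiricalMeasure X n ω) μ m l := by
  refine Finset.measurable_sum _ fun f _ => measurable_absDiff ?_ _
  exact measurable_empiricalMeasure hX hn (measurable_gridIndex l (measurableSet_singleton _))

/-- The power mean inequality costs the number of cells to the power `s - 1`; the masses of the
disjoint cells then add up to at most that of the ring. -/
lemma lintegral_discrepancy_rpow_le {μ : Measure (EuclideanSpace ℝ (Fin d))}
    [IsProbabilityMeasure μ] (hX : ∀ k, Measurable (X k))
    (hlaw : ∀ k, P.map (X k) = μ) (hind : iIndepFun X P)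
    {s : ℝ} (hs₁ : 1 ≤ s) (hs₂ : s ≤ 2) {n : ℕ} (hn : 1 ≤ n) (m l : ℕ) :
    ∫⁻ ω, discrepancy (empiricalMeasure X n ω) μ m l ^ s ∂P ≤
      ENNReal.ofReal ((3 ^ d * (2 ^ l) ^ d) ^ (s - 1) * (3 * (n : ℝ) ^ (1 - s))) *
        μ (ringIndex ⁻¹' {m}) := by
  have hm : ∀ f, MeasurableSet (gridIndex (d := d) l ⁻¹' {(m, f)}) := fun f =>
    measurable_gridIndex l (measurableSet_singleton _)
  calc ∫⁻ ω, discrepancy (empiricalMeasure X n ω) μ m l ^ s ∂P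
      ≤ ∫⁻ ω, ((gridBox d l).card : ℝ≥0∞) ^ (s - 1) * ∑ f ∈ gridBox d l,
          absDiff (empiricalMeasure X n ω (gridIndex l ⁻¹' {(m, f)}))
            (μ (gridIndex l ⁻¹' {(m, f)})) ^ s ∂P :=
        lintegral_mono fun ω => ENNReal.rpow_sum_le_const_mul_sum_rpow _ _ hs₁
    _ = ((gridBox d l).card : ℝ≥0∞) ^ (s - 1) * ∑ f ∈ gridBox d l, ∫⁻ ω,
          absDiff (empiricalMeasure X n ω (gridIndex l ⁻¹' {(m, f)}))
            (μ (gridIndex l ⁻¹' {(m, f)})) ^ s ∂P := by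
        have hmeas : ∀ f, Measurable fun ω =>
            absDiff (empiricalMeasure X n ω (gridIndex l ⁻¹' {(m, f)}))
              (μ (gridIndex l ⁻¹' {(m, f)})) ^ s := fun f =>
          (measurable_absDiff (measurable_empiricalMeasure hX hn (hm f)) _).pow_const s
        rw [lintegral_const_mul _ (Finset.measurable_sum _ fun f _ => hmeas f),
          lintegral_finsetSum _ fun f _ => hmeas f]
    _ ≤ ((gridBox d l).card : ℝ≥0∞) ^ (s - 1) * ∑ f ∈ gridBox d l,
          ENNReal.ofReal (3 * (n : ℝ) ^ (1 - s)) * μ (gridIndex l ⁻¹' {(m, f)}) := by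
        gcongr with f
        exact lintegral_absDiff_rpow_le hX hlaw hind (hm f) hs₁ hs₂ hn
    _ = ((gridBox d l).card : ℝ≥0∞) ^ (s - 1) * (ENNReal.ofReal (3 * (n : ℝ) ^ (1 - s)) *
          μ (⋃ f ∈ gridBox d l, gridIndex l ⁻¹' {(m, f)})) := by
        rw [← Finset.mul_sum, measure_biUnion_finset _ fun f _ => hm f]
        intro f _ g _ hfg
        exact Disjoint.preimage _ (by simpa using hfg)
    _ ≤ ENNReal.ofReal ((3 ^ d * (2 ^ l) ^ d) ^ (s - 1)) *
          (ENNReal.ofReal (3 * (n : ℝ) ^ (1 - s)) * μ (ringIndex ⁻¹' {m})) := by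
        gcongr
        · rw [← ENNReal.ofReal_natCast, ENNReal.ofReal_rpow_of_nonneg (by positivity)
            (by linarith)]
          refine ENNReal.ofReal_le_ofReal (Real.rpow_le_rpow (by positivity) ?_ (by linarith))
          exact card_gridBox_le d l
        · refine Set.iUnion₂_subset fun f _ x hx => ?_
          have : gridIndex l x = (m, f) := hx
          exact congrArg Prod.fst this
    _ = _ := by
        rw [← mul_assoc, ← ENNReal.ofReal_mul (by positivity)]

end Moments

/-! ### Minkowski and Markov inequalities -/

section Lp

variable {Ω : Type*} [MeasurableSpace Ω]

lemma lintegral_Lp_sum_le {ι : Type*} (P : Measure Ω) {f : ι → Ω → ℝ≥0∞}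
    (hf : ∀ i, Measurable (f i)) {s : ℝ} (hs : 1 ≤ s) (S : Finset ι) :
    (∫⁻ ω, (∑ i ∈ S, f i ω) ^ s ∂P) ^ (1 / s) ≤ ∑ i ∈ S, (∫⁻ ω, f i ω ^ s ∂P) ^ (1 / s) := by
  classical
  have hs0 : 0 < s := by linarith
  induction S using Finset.induction_on with
  | empty => simp [ENNReal.zero_rpow_of_pos hs0, hs0]
  | insert a S ha ih =>
    simp_rw [Finset.sum_insert ha]
    exact (ENNReal.lintegral_Lp_add_le (hf a).aemeasurable
      (Finset.measurable_sum S fun i _ => hf i).aemeasurable hs).trans (add_le_add le_rfl ih)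

lemma lintegral_Lp_tsum_le (P : Measure Ω) {f : ℕ → Ω → ℝ≥0∞}
    (hf : ∀ i, Measurable (f i)) {s : ℝ} (hs : 1 ≤ s) :
    (∫⁻ ω, (∑' i, f i ω) ^ s ∂P) ^ (1 / s) ≤ ∑' i, (∫⁻ ω, f i ω ^ s ∂P) ^ (1 / s) := by
  have hs0 : 0 < s := by linarith
  have key : ∫⁻ ω, (∑' i, f i ω) ^ s ∂P = ⨆ n, ∫⁻ ω, (∑ i ∈ Finset.range n, f i ω) ^ s ∂P := by
    rw [← lintegral_iSup]
    · congr 1; ext ω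
      rw [ENNReal.tsum_eq_iSup_nat]
      exact (ENNReal.orderIsoRpow s hs0).map_iSup _
    · intro n; exact (Finset.measurable_sum _ fun i _ => hf i).pow_const s
    · intro a b hab ω
      dsimp only
      gcongr
  rw [one_div, ENNReal.rpow_inv_le_iff hs0, key]
  refine iSup_le fun n => ?_
  rw [← ENNReal.rpow_inv_le_iff hs0, ← one_div]
  exact (lintegral_Lp_sum_le P hf hs _).trans (ENNReal.sum_le_tsum _)

/-- Markov's inequality of order `s`. -/
lemma measure_lt_le_of_Lp_le {P : Measure Ω} {V : Ω → ℝ≥0∞} (hV : Measurable V) {s t N : ℝ}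
    (hs : 1 ≤ s) (ht : 0 < t) (hN : 0 ≤ N)
    (h : (∫⁻ ω, V ω ^ s ∂P) ^ (1 / s) ≤ ENNReal.ofReal N) :
    P {ω | ENNReal.ofReal t < V ω} ≤ ENNReal.ofReal ((N / t) ^ s) := by
  have hs0 : 0 < s := by linarith
  rw [one_div, ENNReal.rpow_inv_le_iff hs0, ENNReal.ofReal_rpow_of_nonneg hN hs0.le] at h
  calc P {ω | ENNReal.ofReal t < V ω} ≤ P {ω | ENNReal.ofReal (t ^ s) ≤ V ω ^ s} := by
        refine measure_mono fun ω hω => ?_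
        simp only [Set.mem_ofPred_eq] at hω ⊢
        rw [← ENNReal.ofReal_rpow_of_nonneg ht.le hs0.le]
        gcongr
    _ ≤ (∫⁻ ω, V ω ^ s ∂P) / ENNReal.ofReal (t ^ s) :=
        meas_ge_le_lintegral_div (hV.pow_const s).aemeasurable
          (by simpa using Real.rpow_pos_of_pos ht s) ENNReal.ofReal_ne_top
    _ ≤ ENNReal.ofReal (N ^ s) / ENNReal.ofReal (t ^ s) := by gcongr
    _ = _ := by
        rw [← ENNReal.ofReal_div_of_pos (Real.rpow_pos_of_pos ht s), Real.div_rpow hN ht.le]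

end Lp

/-! ### Dyadic cut-offs and geometric sums -/

section Real

lemma geom_rpow_eq (β : ℝ) (m : ℕ) : (2 : ℝ) ^ (β * m) = ((2 : ℝ) ^ β) ^ m := by
  rw [Real.rpow_mul (by norm_num), Real.rpow_natCast]

/-- Number of dyadic levels `m` with `2 ^ (p m) < u`. -/
noncomputable def levelCut (p u : ℝ) : ℕ := ⌈Real.logb 2 u / p⌉₊

lemma le_rpow_levelCut {p u : ℝ} (hp : 0 < p) (hu : 0 < u) : u ≤ 2 ^ (p * levelCut p u) := by
  have h : Real.logb 2 u / p ≤ levelCut p u := Nat.le_ceil _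
  rw [div_le_iff₀ hp, mul_comm] at h
  exact (Real.logb_le_iff_le_rpow (by norm_num) hu).1 h

lemma rpow_levelCut_sub_one_le {p u : ℝ} (hp : 0 < p) (hu : 0 < u) (h : levelCut p u ≠ 0) :
    2 ^ (p * ((levelCut p u : ℝ) - 1)) ≤ u := by
  have h1 : levelCut p u - 1 < levelCut p u := by omega
  have h2 := Nat.lt_ceil.1 h1
  rw [Nat.cast_sub (by omega), Nat.cast_one, lt_div_iff₀ hp, mul_comm] at h2
  exact (Real.le_logb_iff_rpow_le (by norm_num) hu).1 h2.le

lemma levelCut_mono {p u v : ℝ} (hp : 0 < p) (hu : 0 < u) (huv : u ≤ v) :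
    levelCut p u ≤ levelCut p v := by
  apply Nat.ceil_mono
  have := Real.logb_le_logb_of_le (b := 2) (by norm_num) hu huv
  gcongr

lemma levelCut_sub_le {p u v : ℝ} (hp : 0 < p) (hu : 0 < u) (huv : u ≤ v) :
    ((levelCut p v - levelCut p u : ℕ) : ℝ) ≤ Real.logb 2 (v / u) / p + 1 := by
  have hv : 0 < v := hu.trans_le huv
  have hlog : 0 ≤ Real.logb 2 (v / u) / p :=
    div_nonneg (Real.logb_nonneg (by norm_num) ((one_le_div hu).2 huv)) hp.le
  rw [Nat.cast_sub (levelCut_mono hp hu huv)]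
  rcases Nat.eq_zero_or_pos (levelCut p v) with h0 | h0
  · rw [h0]
    have : (0 : ℝ) ≤ levelCut p u := by positivity
    push_cast; linarith
  · have h1 : levelCut p v - 1 < levelCut p v := by omega
    have h2 := Nat.lt_ceil.1 h1
    rw [Nat.cast_sub (by omega), Nat.cast_one] at h2
    have h3 : Real.logb 2 u / p ≤ levelCut p u := Nat.le_ceil _
    rw [Real.logb_div hv.ne' hu.ne', sub_div]
    linarith

/-- An increasing geometric sum is comparable to its last term, and the last index `m` satisfies `2
^ (p m) ≤ u`. -/
lemma sum_range_levelCut_le {p u β : ℝ} (hp : 0 < p) (hu : 0 < u) (hβ : 0 < β) :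
    ∑ m ∈ Finset.range (levelCut p u), (2 : ℝ) ^ (p * β * m) ≤
      2 ^ (p * β) / (2 ^ (p * β) - 1) * u ^ β := by
  have hq : (1 : ℝ) < 2 ^ (p * β) := Real.one_lt_rpow (by norm_num) (by positivity)
  rcases eq_or_ne (levelCut p u) 0 with h0 | h0
  · rw [h0]; simp only [Finset.range_zero, Finset.sum_empty]
    have : (0 : ℝ) < 2 ^ (p * β) - 1 := by linarith
    positivity
  · simp_rw [geom_rpow_eq]
    rw [geom_sum_eq hq.ne', div_mul_eq_mul_div]
    have hden : (0 : ℝ) < 2 ^ (p * β) - 1 := by linarith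
    gcongr
    have h1 := Real.rpow_le_rpow (by positivity) (rpow_levelCut_sub_one_le hp hu h0) hβ.le
    have h2 : ((2 : ℝ) ^ (p * β)) ^ levelCut p u =
        2 ^ (p * β) * (2 ^ (p * ((levelCut p u : ℝ) - 1))) ^ β := by
      rw [← Real.rpow_natCast, ← Real.rpow_mul (by norm_num), ← Real.rpow_mul (by norm_num),
        ← Real.rpow_add (by norm_num)]
      congr 1; ring
    rw [h2]
    have := mul_le_mul_of_nonneg_left h1 (by positivity : (0 : ℝ) ≤ 2 ^ (p * β))
    linarith

lemma tsum_ofReal_geom_le {q a : ℝ} (hq0 : 0 ≤ q) (hq : q < 1) (ha : 0 ≤ a) :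
    ∑' k : ℕ, ENNReal.ofReal (a * q ^ k) = ENNReal.ofReal (a / (1 - q)) := by
  rw [← ENNReal.ofReal_tsum_of_nonneg (fun k => by positivity)
    ((summable_geometric_of_lt_one hq0 hq).mul_left a), tsum_mul_left,
    tsum_geometric_of_lt_one hq0 hq, div_eq_mul_inv]

lemma rpow_levelCut_neg_le {p u β : ℝ} (hp : 0 < p) (hu : 0 < u) (hβ : β < 0) :
    (2 : ℝ) ^ (p * β * levelCut p u) ≤ u ^ β := by
  have h := Real.rpow_le_rpow_of_nonpos hu (le_rpow_levelCut hp hu) hβ.le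
  rw [← Real.rpow_mul (by norm_num)] at h
  convert h using 2; ring

end Real

/-- The factor `n ^ ((1 - s) / s) ∑_{l < J} 2 ^ ((d (s - 1) / s - p) l)` bounding the `L ^ s` norm
of the weighted discrepancies of a ring over `J` levels. -/
noncomputable def levelSum (d : ℕ) (p s : ℝ) (n J : ℕ) : ℝ :=
  (n : ℝ) ^ ((1 - s) / s) * ∑ l ∈ Finset.range J, (2 : ℝ) ^ ((d * (s - 1) / s - p) * l)

lemma levelSum_nonneg (d : ℕ) (p s : ℝ) (n J : ℕ) : 0 ≤ levelSum d p s n J :=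
  mul_nonneg (by positivity) (Finset.sum_nonneg fun _ _ => by positivity)

/-! ### The `L ^ s` norm of the discrepancies of one ring -/

section Ring

variable {Ω : Type*} [MeasurableSpace Ω] {P : Measure Ω} [IsProbabilityMeasure P] {d : ℕ}
  {μ : Measure (EuclideanSpace ℝ (Fin d))} [IsProbabilityMeasure μ]
  {X : ℕ → Ω → EuclideanSpace ℝ (Fin d)} {p r s : ℝ}

/-- For `m ≥ 1` the ring lies outside the ball of radius `2 ^ (m - 1)`; the shift by one costs `2 ^
(r p)`, which also covers ring `0`, of mass at most one. -/
lemma measure_ringIndex_le (hp : 1 ≤ p) (hr : 1 < r)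
    (htail : ∀ t, 0 < t → tail μ t ≤ ENNReal.ofReal (t ^ (-(r * p)))) (m : ℕ) :
    μ (ringIndex ⁻¹' {m}) ≤ ENNReal.ofReal (2 ^ (r * p) * 2 ^ (-(r * p * m))) := by
  have hrp : 0 < r * p := by positivity
  rcases Nat.eq_zero_or_pos m with rfl | hm
  · refine prob_le_one.trans ?_
    rw [ENNReal.one_le_ofReal]
    simpa using Real.one_le_rpow (by norm_num) hrp.le
  · have h := htail (2 ^ (m - 1)) (by positivity)
    refine (measure_mono fun x hx => ?_).trans (h.trans (le_of_eq ?_))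
    · have hx' : ringIndex x = m := hx
      change 2 ^ (m - 1) < ‖WithLp.ofLp x‖
      by_contra hcon
      have := (ringIndex_le_iff x (m - 1)).2 (not_lt.1 hcon)
      omega
    · congr 1
      rw [← Real.rpow_natCast, ← Real.rpow_mul (by norm_num), ← Real.rpow_add (by norm_num),
        Nat.cast_sub hm]
      congr 1; push_cast; ring

/-- The discrepancies of ring `m`, weighted by the cost of each of the first `J` levels. -/
noncomputable def ringDiscrepancy (p : ℝ) (μ ν : Measure (EuclideanSpace ℝ (Fin d)))
    (J m : ℕ) : ℝ≥0∞ :=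
  ∑ l ∈ Finset.range J, cellCost p m l * discrepancy μ ν m l

omit [IsProbabilityMeasure μ] in
lemma measurable_ringDiscrepancy (hX : ∀ k, Measurable (X k)) {n : ℕ} (hn : 1 ≤ n) (J m : ℕ) :
    Measurable fun ω => ringDiscrepancy p (empiricalMeasure X n ω) μ J m :=
  Finset.measurable_sum _ fun l _ => (measurable_discrepancy hX hn μ m l).const_mul _

/-- The constant in the moment bounds for the discrepancies. -/
noncomputable def momentConst (d : ℕ) (p r : ℝ) : ℝ := 3 * 3 ^ d * 2 ^ (r * p)

lemma one_le_momentConst (hp : 1 ≤ p) (hr : 1 < r) : 1 ≤ momentConst d p r := by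
  have h1 : (1 : ℝ) ≤ 3 ^ d := one_le_pow₀ (by norm_num)
  have h2 : (1 : ℝ) ≤ 2 ^ (r * p) := Real.one_le_rpow (by norm_num) (by positivity)
  unfold momentConst
  have h3 : (1 : ℝ) ≤ 3 * 3 ^ d := by linarith
  exact one_le_mul_of_one_le_of_one_le h3 h2

lemma moment_constants_le (hp : 1 ≤ p) (hr : 1 < r) (hs₁ : 1 ≤ s) (hs₂ : s ≤ 2)
    {n : ℕ} (hn : 1 ≤ n) (m l : ℕ) :
    ((2 : ℝ) ^ (p * m - p * l)) ^ s * (((3 ^ d * (2 ^ l) ^ d) ^ (s - 1) * (3 * (n : ℝ) ^ (1 - s))) *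
      (2 ^ (r * p) * 2 ^ (-(r * p * m)))) ≤
    (momentConst d p r * ((n : ℝ) ^ ((1 - s) / s) * 2 ^ ((d * (s - 1) / s - p) * l)) *
      2 ^ (p * (1 - r / s) * m)) ^ s := by
  have hs0 : 0 < s := by linarith
  have hn' : (0 : ℝ) < n := by exact_mod_cast hn
  have hC := one_le_momentConst (d := d) hp hr
  have hC0 : 0 ≤ momentConst d p r := by linarith
  have e1 : ((3 : ℝ) ^ d * (2 ^ l) ^ d) ^ (s - 1) =
      (3 ^ d) ^ (s - 1) * 2 ^ (d * (s - 1) * l) := by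
    rw [Real.mul_rpow (by positivity) (by positivity)]
    congr 1
    rw [← pow_mul, ← Real.rpow_natCast, ← Real.rpow_mul (by norm_num)]
    congr 1; push_cast; ring
  have e2 : (momentConst d p r * ((n : ℝ) ^ ((1 - s) / s) * 2 ^ ((d * (s - 1) / s - p) * l)) *
      2 ^ (p * (1 - r / s) * m)) ^ s = momentConst d p r ^ s * ((n : ℝ) ^ (1 - s) *
        2 ^ ((d * (s - 1) - p * s) * l)) * 2 ^ (p * (s - r) * m) := by
    rw [Real.mul_rpow (by positivity) (by positivity), Real.mul_rpow hC0 (by positivity),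
      Real.mul_rpow (by positivity) (by positivity), ← Real.rpow_mul hn'.le,
      ← Real.rpow_mul (by norm_num), ← Real.rpow_mul (by norm_num)]
    have a1 : (1 - s) / s * s = 1 - s := by field_simp
    have a2 : (d * (s - 1) / s - p) * l * s = (d * (s - 1) - p * s) * l := by field_simp
    have a3 : p * (1 - r / s) * m * s = p * (s - r) * m := by field_simp
    rw [a1, a2, a3]
  have e3 : ((2 : ℝ) ^ (p * m - p * l)) ^ s * 2 ^ (d * (s - 1) * l) * 2 ^ (-(r * p * m)) =
      2 ^ ((d * (s - 1) - p * s) * l) * 2 ^ (p * (s - r) * m) := by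
    rw [← Real.rpow_mul (by norm_num), ← Real.rpow_add (by norm_num),
      ← Real.rpow_add (by norm_num), ← Real.rpow_add (by norm_num)]
    congr 1; ring
  have h3 : ((3 : ℝ) ^ d) ^ (s - 1) ≤ 3 ^ d := by
    have := Real.rpow_le_rpow_of_exponent_le (one_le_pow₀ (by norm_num) : (1 : ℝ) ≤ 3 ^ d)
      (by linarith : s - 1 ≤ 1)
    rwa [Real.rpow_one] at this
  -- A constant that is at least one is below its `s`-th power, so `momentConst` can be independent
  -- of `s`.
  have h4 : 3 * ((3 : ℝ) ^ d) ^ (s - 1) * 2 ^ (r * p) ≤ momentConst d p r ^ s := by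
    have := Real.rpow_le_rpow_of_exponent_le hC hs₁
    rw [Real.rpow_one] at this
    refine le_trans ?_ this
    unfold momentConst
    gcongr
  rw [e1, e2]
  calc _ = (3 * ((3 : ℝ) ^ d) ^ (s - 1) * 2 ^ (r * p)) * (n : ℝ) ^ (1 - s) *
        (((2 : ℝ) ^ (p * m - p * l)) ^ s * 2 ^ (d * (s - 1) * l) * 2 ^ (-(r * p * m))) := by ring
    _ ≤ momentConst d p r ^ s * (n : ℝ) ^ (1 - s) *
        (((2 : ℝ) ^ (p * m - p * l)) ^ s * 2 ^ (d * (s - 1) * l) * 2 ^ (-(r * p * m))) := by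
        gcongr
    _ = _ := by rw [e3]; ring

/-- Minkowski's inequality over the levels. The cost `2 ^ (p m)` times the mass bound `2 ^ (-r p m)`
to the power `1 / s` gives the exponent `p (1 - r / s) m`, whose sign changes at `s = r`. -/
lemma Lp_ringDiscrepancy_le (hp : 1 ≤ p) (hr : 1 < r)
    (htail : ∀ t, 0 < t → tail μ t ≤ ENNReal.ofReal (t ^ (-(r * p))))
    (hX : ∀ k, Measurable (X k)) (hlaw : ∀ k, P.map (X k) = μ) (hind : iIndepFun X P)
    (hs₁ : 1 ≤ s) (hs₂ : s ≤ 2) {n : ℕ} (hn : 1 ≤ n) (J m : ℕ) :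
    (∫⁻ ω, ringDiscrepancy p (empiricalMeasure X n ω) μ J m ^ s ∂P) ^ (1 / s) ≤
      ENNReal.ofReal (momentConst d p r * levelSum d p s n J * 2 ^ (p * (1 - r / s) * m)) := by
  have hs0 : 0 < s := by linarith
  have hC0 : 0 ≤ momentConst d p r := by linarith [one_le_momentConst (d := d) hp hr]
  refine (lintegral_Lp_sum_le P (fun l => (measurable_discrepancy hX hn μ m l).const_mul _)
    hs₁ _).trans ?_
  rw [levelSum, Finset.mul_sum, Finset.mul_sum, Finset.sum_mul,
    ENNReal.ofReal_sum_of_nonneg (fun l _ => by positivity)]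
  refine Finset.sum_le_sum fun l _ => ?_
  rw [one_div, ENNReal.rpow_inv_le_iff hs0,
    ENNReal.ofReal_rpow_of_nonneg (by positivity) hs0.le]
  simp_rw [ENNReal.mul_rpow_of_nonneg _ _ hs0.le]
  rw [lintegral_const_mul _ ((measurable_discrepancy hX hn μ m l).pow_const s), cellCost,
    ENNReal.ofReal_rpow_of_nonneg (by positivity) hs0.le]
  refine le_trans ?_ (ENNReal.ofReal_le_ofReal (moment_constants_le hp hr hs₁ hs₂ hn m l))
  rw [ENNReal.ofReal_mul (by positivity)]
  refine mul_le_mul' le_rfl ?_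
  refine (lintegral_discrepancy_rpow_le hX hlaw hind hs₁ hs₂ hn m l).trans ?_
  rw [ENNReal.ofReal_mul (p := (3 ^ d * (2 ^ l) ^ d) ^ (s - 1) * (3 * (n : ℝ) ^ (1 - s)))
    (by positivity)]
  refine mul_le_mul' (α := ℝ≥0∞) le_rfl ?_
  exact measure_ringIndex_le hp hr htail m

end Ring

/-! ### Deviations of groups of rings -/

/-- With the cut at `y * v`, Markov's `y ^ (-s)` meets `y ^ (s - r)`: the power of `y` is `-r`
whatever `s` is. -/
lemma rescaled_markov_eq {c A y v r s : ℝ} (hc : 0 ≤ c) (hA : 0 ≤ A) (hy : 0 < y) (hv : 0 < v)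
    (hs : 0 < s) :
    (c * A * (y * v) ^ (1 - r / s) / y) ^ s = c ^ s * (A ^ s * v ^ (s - r)) * y ^ (-r) := by
  rw [Real.div_rpow (by positivity) hy.le, Real.mul_rpow (by positivity) (by positivity),
    Real.mul_rpow hc hA, ← Real.rpow_mul (by positivity)]
  have e : (1 - r / s) * s = s - r := by field_simp
  rw [e, Real.mul_rpow hy.le hv.le, Real.rpow_sub hy, Real.rpow_neg hy.le]
  have := Real.rpow_pos_of_pos hy s
  field_simp

section Groups

variable {Ω : Type*} [MeasurableSpace Ω] {P : Measure Ω} [IsProbabilityMeasure P] {d : ℕ}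
  {μ : Measure (EuclideanSpace ℝ (Fin d))} [IsProbabilityMeasure μ]
  {X : ℕ → Ω → EuclideanSpace ℝ (Fin d)} {p r s : ℝ}

lemma measure_sum_ringDiscrepancy_le (hp : 1 ≤ p) (hr : 1 < r)
    (htail : ∀ t, 0 < t → tail μ t ≤ ENNReal.ofReal (t ^ (-(r * p))))
    (hX : ∀ k, Measurable (X k)) (hlaw : ∀ k, P.map (X k) = μ) (hind : iIndepFun X P)
    (hs₁ : 1 ≤ s) (hs₂ : s ≤ 2) {n : ℕ} (hn : 1 ≤ n) (J : ℕ) (F : Finset ℕ) {b t : ℝ}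
    (hb : ∑ m ∈ F, (2 : ℝ) ^ (p * (1 - r / s) * m) ≤ b) (ht : 0 < t) :
    P {ω | ENNReal.ofReal t < ∑ m ∈ F, ringDiscrepancy p (empiricalMeasure X n ω) μ J m} ≤
      ENNReal.ofReal ((momentConst d p r * levelSum d p s n J * b / t) ^ s) := by
  have hC0 : 0 ≤ momentConst d p r := by linarith [one_le_momentConst (d := d) hp hr]
  have hA := levelSum_nonneg d p s n J
  have hb0 : 0 ≤ b := (Finset.sum_nonneg fun _ _ => by positivity).trans hb
  have hm := measurable_ringDiscrepancy (p := p) (μ := μ) hX hn J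
  refine measure_lt_le_of_Lp_le (Finset.measurable_sum F fun m _ => hm m) hs₁ ht
    (by positivity) ?_
  refine (lintegral_Lp_sum_le P hm hs₁ F).trans ?_
  refine (Finset.sum_le_sum fun m _ =>
    Lp_ringDiscrepancy_le hp hr htail hX hlaw hind hs₁ hs₂ hn J m).trans ?_
  rw [← ENNReal.ofReal_sum_of_nonneg (fun m _ => by positivity), ← Finset.mul_sum]
  gcongr

/-- For `s < r` the ring bounds decay geometrically, so the infinitely many high rings cost no more,
up to a constant, than the first of them. -/
lemma measure_tsum_ringDiscrepancy_le (hp : 1 ≤ p) (hr : 1 < r)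
    (htail : ∀ t, 0 < t → tail μ t ≤ ENNReal.ofReal (t ^ (-(r * p))))
    (hX : ∀ k, Measurable (X k)) (hlaw : ∀ k, P.map (X k) = μ) (hind : iIndepFun X P)
    (hs₁ : 1 ≤ s) (hs₂ : s ≤ 2) (hsr : s < r) {n : ℕ} (hn : 1 ≤ n) (J : ℕ) {u t : ℝ}
    (hu : 0 < u) (ht : 0 < t) :
    P {ω | ENNReal.ofReal t <
        ∑' m, ringDiscrepancy p (empiricalMeasure X n ω) μ J (m + levelCut p u)} ≤
      ENNReal.ofReal ((momentConst d p r * levelSum d p s n J *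
        (u ^ (1 - r / s) / (1 - 2 ^ (p * (1 - r / s)))) / t) ^ s) := by
  have hC0 : 0 ≤ momentConst d p r := by linarith [one_le_momentConst (d := d) hp hr]
  have hA := levelSum_nonneg d p s n J
  have hβ : 1 - r / s < 0 := by
    have : 1 < r / s := (one_lt_div (by linarith)).2 hsr
    linarith
  have hp0 : 0 < p := by linarith
  have hq : (2 : ℝ) ^ (p * (1 - r / s)) < 1 :=
    Real.rpow_lt_one_of_one_lt_of_neg (by norm_num) (mul_neg_of_pos_of_neg hp0 hβ)
  have hq' : 0 < 1 - (2 : ℝ) ^ (p * (1 - r / s)) := by linarith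
  have hm := measurable_ringDiscrepancy (p := p) (μ := μ) hX hn J
  refine measure_lt_le_of_Lp_le (Measurable.tsum fun m => hm _) hs₁ ht
    (by positivity) ?_
  refine (lintegral_Lp_tsum_le P (fun m => hm _) hs₁).trans ?_
  refine (ENNReal.tsum_le_tsum fun m =>
    Lp_ringDiscrepancy_le hp hr htail hX hlaw hind hs₁ hs₂ hn J _).trans ?_
  have e : ∀ m : ℕ, momentConst d p r * levelSum d p s n J *
      2 ^ (p * (1 - r / s) * ((m + levelCut p u : ℕ) : ℝ)) =
      (momentConst d p r * levelSum d p s n J * 2 ^ (p * (1 - r / s) * levelCut p u)) *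
        (2 ^ (p * (1 - r / s))) ^ m := by
    intro m
    rw [← geom_rpow_eq, mul_assoc _ ((2 : ℝ) ^ _) ((2 : ℝ) ^ _), ← Real.rpow_add (by norm_num)]
    congr 2; push_cast; ring
  simp_rw [e]
  rw [tsum_ofReal_geom_le (by positivity) hq (by positivity), mul_div_assoc]
  gcongr
  exact rpow_levelCut_neg_le hp0 hu hβ

/-- The series over the rings has ratio `2 ^ (p (1 - r))`, less than one because `r > 1`. -/
lemma tsum_cellCost_mul_le (hp : 1 ≤ p) (hr : 1 < r)
    (htail : ∀ t, 0 < t → tail μ t ≤ ENNReal.ofReal (t ^ (-(r * p)))) (J : ℕ) :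
    ∑' m, cellCost p m J * μ (ringIndex ⁻¹' {m}) ≤
      ENNReal.ofReal (2 ^ (r * p) * 2 ^ (-(p * J)) / (1 - 2 ^ (p * (1 - r)))) := by
  have hq : (2 : ℝ) ^ (p * (1 - r)) < 1 :=
    Real.rpow_lt_one_of_one_lt_of_neg (by norm_num) (by nlinarith)
  rw [← tsum_ofReal_geom_le (by positivity) hq (by positivity)]
  refine ENNReal.tsum_le_tsum fun m => ?_
  refine (mul_le_mul' le_rfl (measure_ringIndex_le hp hr htail m)).trans (le_of_eq ?_)
  rw [cellCost, ← ENNReal.ofReal_mul (by positivity), ← geom_rpow_eq]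
  congr 1
  have e : (2 : ℝ) ^ (p * m - p * J) * 2 ^ (-(r * p * m)) =
      2 ^ (-(p * J)) * 2 ^ (p * (1 - r) * m) := by
    rw [← Real.rpow_add (by norm_num), ← Real.rpow_add (by norm_num)]
    congr 1; ring
  linear_combination (2 : ℝ) ^ (r * p) * e

end Groups

lemma lt_of_four_terms {D y : ℝ} (hD : 0 < D) (hy : 0 < y) {W L M H R : ℝ≥0∞}
    (hW : W ≤ ENNReal.ofReal D * (L + M + H) + R) (hR : R ≤ ENNReal.ofReal (y / 4))
    (h : ENNReal.ofReal y < W) :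
    ENNReal.ofReal (y / (4 * D)) < L ∨ ENNReal.ofReal (y / (4 * D)) < M ∨
      ENNReal.ofReal (y / (4 * D)) < H := by
  by_contra! hcon
  obtain ⟨h1, h2, h3⟩ := hcon
  refine absurd (h.trans_le hW) (not_lt.2 ?_)
  calc ENNReal.ofReal D * (L + M + H) + R
      ≤ ENNReal.ofReal D * (ENNReal.ofReal (y / (4 * D)) + ENNReal.ofReal (y / (4 * D)) +
        ENNReal.ofReal (y / (4 * D))) + ENNReal.ofReal (y / 4) := by gcongr
    _ = ENNReal.ofReal y := by
        rw [← ENNReal.ofReal_add (by positivity) (by positivity),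
          ← ENNReal.ofReal_add (by positivity) (by positivity),
          ← ENNReal.ofReal_mul (by positivity),
          ← ENNReal.ofReal_add (by positivity) (by positivity)]
        congr 1; field_simp; ring

lemma measure_wassersteinPow_le_three_groups {Ω : Type*} [MeasurableSpace Ω] {P : Measure Ω}
    {d : ℕ} (hd : 1 ≤ d) {μ : Measure (EuclideanSpace ℝ (Fin d))} [IsProbabilityMeasure μ]
    {X : ℕ → Ω → EuclideanSpace ℝ (Fin d)} {p y D : ℝ} (hp : 1 ≤ p) (hy : 0 < y)
    (hD : D = (2 * √d) ^ p) {n J m₁ m₂ : ℕ} (hn : 1 ≤ n) (hJ : 1 ≤ J) (hm : m₁ ≤ m₂)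
    (hsmall : ENNReal.ofReal D * ∑' m, cellCost p m J * μ (ringIndex ⁻¹' {m}) ≤
      ENNReal.ofReal (y / 4)) :
    P {ω | ENNReal.ofReal y < wassersteinPow p (empiricalMeasure X n ω) μ} ≤
      P {ω | ENNReal.ofReal (y / (4 * D)) <
        ∑ m ∈ Finset.range m₁, ringDiscrepancy p (empiricalMeasure X n ω) μ J m} +
      (P {ω | ENNReal.ofReal (y / (4 * D)) <
        ∑ m ∈ Finset.Ico m₁ m₂, ringDiscrepancy p (empiricalMeasure X n ω) μ J m} +
      P {ω | ENNReal.ofReal (y / (4 * D)) <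
        ∑' m, ringDiscrepancy p (empiricalMeasure X n ω) μ J (m + m₂)}) := by
  have hD0 : 0 < D := by
    have : (0 : ℝ) < d := by exact_mod_cast hd
    rw [hD]; positivity
  have key : ∀ ω, wassersteinPow p (empiricalMeasure X n ω) μ ≤ ENNReal.ofReal D *
      (∑ m ∈ Finset.range m₁, ringDiscrepancy p (empiricalMeasure X n ω) μ J m +
        ∑ m ∈ Finset.Ico m₁ m₂, ringDiscrepancy p (empiricalMeasure X n ω) μ J m +
        ∑' m, ringDiscrepancy p (empiricalMeasure X n ω) μ J (m + m₂)) +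
      ENNReal.ofReal D * ∑' m, cellCost p m J * μ (ringIndex ⁻¹' {m}) := by
    intro ω
    have := isProbabilityMeasure_empiricalMeasure (X := X) hn ω
    rw [Finset.sum_range_add_sum_Ico _ hm, Summable.sum_add_tsum_nat_add'
      (f := fun m => ringDiscrepancy p (empiricalMeasure X n ω) μ J m) ENNReal.summable, hD]
    exact wassersteinPow_le_discrepancy hp _ μ hJ
  refine (measure_mono ?_).trans ((measure_union_le _ _).trans
    (add_le_add le_rfl (measure_union_le _ _)))
  intro ω hω
  exact lt_of_four_terms hD0 hy (key ω) hsmall hω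

/-- The four terms come from the low, middle and high rings and from the remainder below the finest
scale. The parameters `v₁`, `v₂` and `J` stay free, to be tuned in each regime. -/
lemma exists_deviation_bound_of_tail_le {d : ℕ} (hd : 1 ≤ d) {p r s₁ s₂ : ℝ} (hp : 1 ≤ p)
    (hr₁ : 1 < r) (hr₂ : r < 2) (h1s₁ : 1 ≤ s₁) (hs₁r : s₁ < r) (hrs₂ : r < s₂) (hs₂ : s₂ ≤ 2) :
    ∃ C : ℝ, 0 < C ∧ ∀ (Ω : Type*) [MeasurableSpace Ω] (P : Measure Ω) [IsProbabilityMeasure P]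
      (μ : Measure (EuclideanSpace ℝ (Fin d))) [IsProbabilityMeasure μ]
      (X : ℕ → Ω → EuclideanSpace ℝ (Fin d)),
      (∀ k, Measurable (X k)) → (∀ k, P.map (X k) = μ) → iIndepFun X P →
      (∀ t, 0 < t → tail μ t ≤ ENNReal.ofReal (t ^ (-(r * p)))) →
      ∀ n J : ℕ, 1 ≤ n → 1 ≤ J → ∀ y v₁ v₂ : ℝ, 0 < y → 0 < v₁ → v₁ ≤ v₂ →
        P {ω | ENNReal.ofReal y < wassersteinPow p (empiricalMeasure X n ω) μ} ≤
          ENNReal.ofReal (C * (levelSum d p s₂ n J ^ s₂ * v₁ ^ (s₂ - r) +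
            (levelSum d p r n J * (Real.logb 2 (v₂ / v₁) / p + 1)) ^ r +
            levelSum d p s₁ n J ^ s₁ * v₂ ^ (s₁ - r) + (2 ^ (-(p * J))) ^ r) * y ^ (-r)) := by
  have hp0 : 0 < p := by linarith
  have hr0 : 0 < r := by linarith
  have hs₁0 : 0 < s₁ := by linarith
  have hs₂0 : 0 < s₂ := by linarith
  obtain ⟨D, hDdef⟩ : ∃ D : ℝ, D = (2 * √d) ^ p := ⟨_, rfl⟩
  have hD : 0 < D := by
    have : (0 : ℝ) < d := by exact_mod_cast hd
    rw [hDdef]; positivity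
  obtain ⟨M, hM⟩ : ∃ M : ℝ, M = momentConst d p r := ⟨_, rfl⟩
  have hM0 : 0 < M := by linarith [one_le_momentConst (d := d) hp hr₁]
  have hβ₂ : 0 < 1 - r / s₂ := by
    have : r / s₂ < 1 := (div_lt_one hs₂0).2 hrs₂
    linarith
  have hβ₁ : 1 - r / s₁ < 0 := by
    have : 1 < r / s₁ := (one_lt_div hs₁0).2 hs₁r
    linarith
  obtain ⟨K₂, hK₂⟩ : ∃ K : ℝ, K = 2 ^ (p * (1 - r / s₂)) / (2 ^ (p * (1 - r / s₂)) - 1) :=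
    ⟨_, rfl⟩
  have hK₂0 : 0 < K₂ := by
    have : (1 : ℝ) < 2 ^ (p * (1 - r / s₂)) := Real.one_lt_rpow (by norm_num) (by positivity)
    have : (0 : ℝ) < 2 ^ (p * (1 - r / s₂)) - 1 := by linarith
    rw [hK₂]; positivity
  obtain ⟨K₁, hK₁⟩ : ∃ K : ℝ, K = (1 - 2 ^ (p * (1 - r / s₁)))⁻¹ := ⟨_, rfl⟩
  have hK₁0 : 0 < K₁ := by
    have : (2 : ℝ) ^ (p * (1 - r / s₁)) < 1 :=
      Real.rpow_lt_one_of_one_lt_of_neg (by norm_num) (mul_neg_of_pos_of_neg hp0 hβ₁)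
    have : 0 < 1 - (2 : ℝ) ^ (p * (1 - r / s₁)) := by linarith
    rw [hK₁]; positivity
  obtain ⟨K₀, hK₀⟩ : ∃ K : ℝ, K = D * (2 ^ (r * p) / (1 - 2 ^ (p * (1 - r)))) := ⟨_, rfl⟩
  have hK₀0 : 0 < K₀ := by
    have : (2 : ℝ) ^ (p * (1 - r)) < 1 :=
      Real.rpow_lt_one_of_one_lt_of_neg (by norm_num) (by nlinarith)
    have : 0 < 1 - (2 : ℝ) ^ (p * (1 - r)) := by linarith
    rw [hK₀]; positivity
  obtain ⟨c₂, hc₂⟩ : ∃ c : ℝ, c = (4 * D * M * K₂) ^ s₂ := ⟨_, rfl⟩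
  obtain ⟨c₁, hc₁⟩ : ∃ c : ℝ, c = (4 * D * M * K₁) ^ s₁ := ⟨_, rfl⟩
  obtain ⟨c, hc⟩ : ∃ c : ℝ, c = (4 * D * M) ^ r := ⟨_, rfl⟩
  obtain ⟨c₀, hc₀⟩ : ∃ c : ℝ, c = (4 * K₀) ^ r := ⟨_, rfl⟩
  have hc₂0 : 0 < c₂ := by rw [hc₂]; positivity
  have hc₁0 : 0 < c₁ := by rw [hc₁]; positivity
  have hc0 : 0 < c := by rw [hc]; positivity
  have hc₀0 : 0 < c₀ := by rw [hc₀]; positivity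
  refine ⟨c₂ + c + c₁ + c₀, by positivity, ?_⟩
  intro Ω _ P _ μ _ X hX hlaw hind htail n J hn hJ y v₁ v₂ hy hv₁ hv₁₂
  have hv₂ : 0 < v₂ := hv₁.trans_le hv₁₂
  obtain ⟨A₂, hA₂⟩ : ∃ A, A = levelSum d p s₂ n J := ⟨_, rfl⟩
  obtain ⟨A₁, hA₁⟩ : ∃ A, A = levelSum d p s₁ n J := ⟨_, rfl⟩
  obtain ⟨A, hA⟩ : ∃ A, A = levelSum d p r n J := ⟨_, rfl⟩
  have hA₂0 : 0 ≤ A₂ := hA₂ ▸ levelSum_nonneg _ _ _ _ _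
  have hA₁0 : 0 ≤ A₁ := hA₁ ▸ levelSum_nonneg _ _ _ _ _
  have hA0 : 0 ≤ A := hA ▸ levelSum_nonneg _ _ _ _ _
  obtain ⟨N, hN⟩ : ∃ N : ℝ, N = Real.logb 2 (v₂ / v₁) / p + 1 := ⟨_, rfl⟩
  have hN0 : 0 ≤ N := by
    have := div_nonneg (Real.logb_nonneg (b := 2) (by norm_num) ((one_le_div hv₁).2 hv₁₂)) hp0.le
    linarith
  rw [← hA₂, ← hA₁, ← hA, ← hN]
  obtain ⟨T₂, hT₂⟩ : ∃ T, T = A₂ ^ s₂ * v₁ ^ (s₂ - r) := ⟨_, rfl⟩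
  obtain ⟨T₁, hT₁⟩ : ∃ T, T = A₁ ^ s₁ * v₂ ^ (s₁ - r) := ⟨_, rfl⟩
  obtain ⟨T, hT⟩ : ∃ T, T = (A * N) ^ r := ⟨_, rfl⟩
  obtain ⟨T₀, hT₀⟩ : ∃ T, T = ((2 : ℝ) ^ (-(p * J))) ^ r := ⟨_, rfl⟩
  have hT₂0 : 0 ≤ T₂ := by rw [hT₂]; positivity
  have hT₁0 : 0 ≤ T₁ := by rw [hT₁]; positivity
  have hT0 : 0 ≤ T := by rw [hT]; positivity
  have hT₀0 : 0 ≤ T₀ := by rw [hT₀]; positivity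
  rw [← hT₂, ← hT₁, ← hT, ← hT₀]
  obtain ⟨Y, hY⟩ : ∃ Y, Y = y ^ (-r) := ⟨_, rfl⟩
  have hY0 : 0 < Y := by rw [hY]; positivity
  rw [← hY]
  have hsplit : (c₂ * T₂ + c * T + c₁ * T₁ + c₀ * T₀) * Y ≤
      (c₂ + c + c₁ + c₀) * (T₂ + T + T₁ + T₀) * Y := by
    have g₂ : c₂ ≤ c₂ + c + c₁ + c₀ := by linarith
    have g : c ≤ c₂ + c + c₁ + c₀ := by linarith
    have g₁ : c₁ ≤ c₂ + c + c₁ + c₀ := by linarith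
    have g₀ : c₀ ≤ c₂ + c + c₁ + c₀ := by linarith
    rw [mul_add, mul_add, mul_add]
    gcongr
  refine le_trans ?_ (ENNReal.ofReal_le_ofReal hsplit)
  have hRbound : ENNReal.ofReal D * ∑' m, cellCost p m J * μ (ringIndex ⁻¹' {m}) ≤
      ENNReal.ofReal (K₀ * 2 ^ (-(p * J))) := by
    refine (mul_le_mul' le_rfl (tsum_cellCost_mul_le hp hr₁ htail J)).trans (le_of_eq ?_)
    rw [← ENNReal.ofReal_mul hD.le]
    congr 1; rw [hK₀]; ring
  -- Either the deterministic remainder uses at most a quarter of `y`, or `y` is so small that the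
  -- last term alone makes the bound at least one.
  rcases le_or_gt (K₀ * 2 ^ (-(p * J))) (y / 4) with hsmall | hlarge
  · have ht : 0 < y / (4 * D) := by positivity
    have hu₁ : 0 < y * v₁ := by positivity
    have hu₂ : 0 < y * v₂ := by positivity
    have hu : y * v₁ ≤ y * v₂ := by gcongr
    have b₂ := measure_sum_ringDiscrepancy_le hp hr₁ htail hX hlaw hind (by linarith : 1 ≤ s₂) hs₂
      hn J (Finset.range (levelCut p (y * v₁))) (sum_range_levelCut_le hp0 hu₁ hβ₂) ht
    have b₁ := measure_tsum_ringDiscrepancy_le hp hr₁ htail hX hlaw hind h1s₁ (by linarith) hs₁r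
      hn J hu₂ ht
    have hcount : ∑ m ∈ Finset.Ico (levelCut p (y * v₁)) (levelCut p (y * v₂)),
        (2 : ℝ) ^ (p * (1 - r / r) * m) ≤ N := by
      -- At `s = r` every ring has weight one, so the sum counts the middle rings.
      rw [div_self hr0.ne']
      simp only [sub_self, mul_zero, zero_mul, Real.rpow_zero, Finset.sum_const, Nat.card_Ico,
        nsmul_eq_mul, mul_one]
      refine (levelCut_sub_le hp0 hu₁ hu).trans (le_of_eq ?_)
      rw [mul_div_mul_left _ _ hy.ne', hN]
    have b := measure_sum_ringDiscrepancy_le hp hr₁ htail hX hlaw hind hr₁.le hr₂.le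
      hn J _ hcount ht
    rw [← hM, ← hA₂, ← hK₂] at b₂
    rw [← hM, ← hA₁, div_eq_mul_inv _ (1 - _), ← hK₁] at b₁
    rw [← hM, ← hA] at b
    have e₂ : (M * A₂ * (K₂ * (y * v₁) ^ (1 - r / s₂)) / (y / (4 * D))) ^ s₂ =
        c₂ * T₂ * Y := by
      rw [hc₂, hT₂, hY, ← rescaled_markov_eq (by positivity) hA₂0 hy hv₁ hs₂0]
      congr 1; field_simp
    have e₁ : (M * A₁ * ((y * v₂) ^ (1 - r / s₁) * K₁) / (y / (4 * D))) ^ s₁ =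
        c₁ * T₁ * Y := by
      rw [hc₁, hT₁, hY, ← rescaled_markov_eq (by positivity) hA₁0 hy hv₂ hs₁0]
      congr 1; field_simp
    have e : (M * A * N / (y / (4 * D))) ^ r = c * T * Y := by
      have : M * A * N / (y / (4 * D)) = 4 * D * M * (A * N) / y := by field_simp
      rw [this, Real.div_rpow (by positivity) hy.le, Real.mul_rpow (by positivity) (by positivity),
        hY, Real.rpow_neg hy.le, hc, hT, div_eq_mul_inv]
    rw [e₂] at b₂
    rw [e₁] at b₁
    rw [e] at b
    refine (measure_wassersteinPow_le_three_groups hd hp hy hDdef hn hJ (levelCut_mono hp0 hu₁ hu)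
      (hRbound.trans (ENNReal.ofReal_le_ofReal hsmall))).trans
      ((add_le_add b₂ (add_le_add b b₁)).trans ?_)
    rw [← ENNReal.ofReal_add (by positivity) (by positivity),
      ← ENNReal.ofReal_add (by positivity) (by positivity)]
    refine ENNReal.ofReal_le_ofReal ?_
    have : 0 ≤ c₀ * T₀ * Y := by positivity
    linarith
  · refine prob_le_one.trans ?_
    rw [ENNReal.one_le_ofReal]
    have h1 : 1 ≤ 4 * K₀ * 2 ^ (-(p * J)) / y := by
      rw [one_le_div hy]; linarith
    have h2 := Real.one_le_rpow h1 hr0.le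
    rw [Real.div_rpow (by positivity) hy.le, Real.mul_rpow (by positivity) (by positivity),
      div_eq_mul_inv, ← Real.rpow_neg hy.le, ← hc₀, ← hT₀, ← hY] at h2
    have : 0 ≤ (c₂ * T₂ + c * T + c₁ * T₁) * Y := by positivity
    linarith

/-! ### Sums over the levels when `2 ^ (d J)` is about `n` -/

section LevelSum

variable {d : ℕ} {p r s : ℝ}

lemma two_rpow_neg_levelCut_le (hd : 1 ≤ d) (hp : 0 < p) {n : ℕ} (hn : 2 ≤ n) :
    (2 : ℝ) ^ (-(p * levelCut d n)) ≤ (n : ℝ) ^ (-(p / d)) := by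
  have hd0 : (0 : ℝ) < d := by exact_mod_cast hd
  have hn0 : (0 : ℝ) < n := by exact_mod_cast (by omega : 0 < n)
  have h := rpow_levelCut_neg_le hd0 hn0 (by rw [neg_lt_zero]; positivity : -(p / d) < 0)
  refine le_trans (le_of_eq ?_) h
  congr 1; field_simp

lemma one_le_levelCut (hd : 1 ≤ d) {n : ℕ} (hn : 2 ≤ n) : 1 ≤ levelCut d n := by
  have hd0 : (0 : ℝ) < d := by exact_mod_cast hd
  have hn1 : (1 : ℝ) < n := by exact_mod_cast (by omega : 1 < n)
  exact Nat.ceil_pos.2 (div_pos (Real.logb_pos (by norm_num) hn1) hd0)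

lemma one_le_logb_natCast {n : ℕ} (hn : 2 ≤ n) : 1 ≤ Real.logb 2 n := by
  rw [Real.le_logb_iff_rpow_le (by norm_num) (by exact_mod_cast (by omega : 0 < n)),
    Real.rpow_one]
  exact_mod_cast hn

lemma levelCut_le_two_mul_logb (hd : 1 ≤ d) {n : ℕ} (hn : 2 ≤ n) :
    (levelCut d n : ℝ) ≤ 2 * Real.logb 2 n := by
  have hd1 : (1 : ℝ) ≤ d := by exact_mod_cast hd
  have hL := one_le_logb_natCast hn
  have h : Real.logb 2 n / d ≤ Real.logb 2 n := div_le_self (by linarith) hd1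
  have := Nat.ceil_lt_add_one (div_nonneg (by linarith : 0 ≤ Real.logb 2 n) (by linarith : (0 : ℝ) ≤ d))
  unfold levelCut
  linarith

/-- The ratio is below one, so the sum over levels is bounded independently of their number and only
`n ^ ((1 - s) / s)` remains. -/
lemma exists_levelSum_le_of_lt (hs : 1 ≤ s) (h : d * (s - 1) / s < p) (r : ℝ) :
    ∃ C : ℝ, 0 < C ∧ ∀ n : ℕ, 2 ≤ n →
      levelSum d p s n (levelCut d n) ^ s * (n : ℝ) ^ (s - r) ≤ C * (n : ℝ) ^ (1 - r) := by
  have hs0 : 0 < s := by linarith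
  set e := d * (s - 1) / s - p with he
  have hq : (2 : ℝ) ^ e < 1 := Real.rpow_lt_one_of_one_lt_of_neg (by norm_num) (by linarith)
  have hq' : 0 < 1 - (2 : ℝ) ^ e := by linarith
  refine ⟨((1 - (2 : ℝ) ^ e)⁻¹) ^ s, by positivity, fun n hn => ?_⟩
  have hn0 : (0 : ℝ) < n := by exact_mod_cast (by omega : 0 < n)
  have hsum : ∑ l ∈ Finset.range (levelCut d n), (2 : ℝ) ^ (e * l) ≤ (1 - (2 : ℝ) ^ e)⁻¹ := by
    simp_rw [geom_rpow_eq]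
    rw [← tsum_geometric_of_lt_one (by positivity) hq]
    exact (summable_geometric_of_lt_one (by positivity) hq).sum_le_tsum _
      fun _ _ => by positivity
  have hA : levelSum d p s n (levelCut d n) ≤
      (n : ℝ) ^ ((1 - s) / s) * (1 - (2 : ℝ) ^ e)⁻¹ := by
    unfold levelSum; gcongr
  calc levelSum d p s n (levelCut d n) ^ s * (n : ℝ) ^ (s - r)
      ≤ ((n : ℝ) ^ ((1 - s) / s) * (1 - (2 : ℝ) ^ e)⁻¹) ^ s * (n : ℝ) ^ (s - r) := by
        gcongr; exact levelSum_nonneg _ _ _ _ _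
    _ = ((1 - (2 : ℝ) ^ e)⁻¹) ^ s * ((n : ℝ) ^ (1 - s) * (n : ℝ) ^ (s - r)) := by
        rw [Real.mul_rpow (by positivity) (by positivity), ← Real.rpow_mul hn0.le,
          div_mul_cancel₀ _ hs0.ne']
        ring
    _ = _ := by
        rw [← Real.rpow_add hn0]; congr 2; ring

/-- The ratio exceeds one, so the finest level dominates. With about `n` cells in a ring the
exponents `(1 - s) / s` and `(s - 1) / s` cancel, which leaves `n ^ (-p / d)` for every such `s`. -/
lemma exists_levelSum_le_of_gt (hd : 1 ≤ d) (hs : 1 ≤ s) (h : p < d * (s - 1) / s) (r : ℝ) :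
    ∃ C : ℝ, 0 < C ∧ ∀ n : ℕ, 2 ≤ n →
      levelSum d p s n (levelCut d n) ^ s * ((n : ℝ) ^ (p / d)) ^ (s - r) ≤
        C * (n : ℝ) ^ (-(p / d * r)) := by
  have hs0 : 0 < s := by linarith
  have hd0 : (0 : ℝ) < d := by exact_mod_cast hd
  set β := (d * (s - 1) / s - p) / d with hβ
  have hβ0 : 0 < β := div_pos (by linarith) hd0
  have hq : (1 : ℝ) < 2 ^ (d * β) := Real.one_lt_rpow (by norm_num) (by positivity)
  obtain ⟨K, hK⟩ : ∃ K : ℝ, K = 2 ^ (d * β) / (2 ^ (d * β) - 1) := ⟨_, rfl⟩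
  have hK0 : 0 < K := by
    have : (0 : ℝ) < 2 ^ (d * β) - 1 := by linarith
    rw [hK]; positivity
  refine ⟨K ^ s, by positivity, fun n hn => ?_⟩
  have hn0 : (0 : ℝ) < n := by exact_mod_cast (by omega : 0 < n)
  have hsum := sum_range_levelCut_le hd0 hn0 hβ0
  rw [← hK] at hsum
  have hdβ : d * β = d * (s - 1) / s - p := by rw [hβ]; field_simp
  have hA : levelSum d p s n (levelCut d n) ≤ K * (n : ℝ) ^ (-(p / d)) := by
    unfold levelSum
    rw [← hdβ]
    calc (n : ℝ) ^ ((1 - s) / s) * ∑ l ∈ Finset.range (levelCut d n), (2 : ℝ) ^ (d * β * l)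
        ≤ (n : ℝ) ^ ((1 - s) / s) * (K * (n : ℝ) ^ β) := by gcongr
      _ = K * ((n : ℝ) ^ ((1 - s) / s) * (n : ℝ) ^ β) := by ring
      _ = _ := by
        rw [← Real.rpow_add hn0]
        congr 2; rw [hβ]; field_simp; ring
  calc levelSum d p s n (levelCut d n) ^ s * ((n : ℝ) ^ (p / d)) ^ (s - r)
      ≤ (K * (n : ℝ) ^ (-(p / d))) ^ s * ((n : ℝ) ^ (p / d)) ^ (s - r) := by
        gcongr; exact levelSum_nonneg _ _ _ _ _
    _ = K ^ s * ((n : ℝ) ^ (-(p / d) * s) * (n : ℝ) ^ (p / d * (s - r))) := by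
        rw [Real.mul_rpow (by positivity) (by positivity), ← Real.rpow_mul hn0.le,
          ← Real.rpow_mul hn0.le, mul_assoc]
    _ = _ := by
        rw [← Real.rpow_add hn0]; congr 2; ring

lemma levelSum_of_eq (h : p = d * (s - 1) / s) (n J : ℕ) :
    levelSum d p s n J = (n : ℝ) ^ ((1 - s) / s) * J := by
  simp [levelSum, ← h]

end LevelSum

/-- For laws with `H(t) ≤ t ^ (- r p)`, the deviations of `W_p^p(μ_n, μ)` above the level `y` have
probability at most of order `R n * y ^ (- r)`. -/
def HasDeviationRate.{u} (d : ℕ) (p r : ℝ) (R : ℕ → ℝ) : Prop :=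
  ∃ C : ℝ, 0 < C ∧ ∀ (Ω : Type u) [MeasurableSpace Ω] (P : Measure Ω) [IsProbabilityMeasure P]
    (μ : Measure (EuclideanSpace ℝ (Fin d))) [IsProbabilityMeasure μ]
    (X : ℕ → Ω → EuclideanSpace ℝ (Fin d)),
    (∀ k, Measurable (X k)) → (∀ k, P.map (X k) = μ) → iIndepFun X P →
    (∀ t, 0 < t → tail μ t ≤ ENNReal.ofReal (t ^ (-(r * p)))) →
    ∀ n : ℕ, 2 ≤ n → ∀ y : ℝ, 0 < y →
      P {ω | ENNReal.ofReal y < wassersteinPow p (empiricalMeasure X n ω) μ} ≤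
        ENNReal.ofReal (C * R n * y ^ (-r))

/-! ### The rates in the three regimes -/

section Rates

variable {d : ℕ} {p r : ℝ}

lemma hasDeviationRate_of_bound (hd : 1 ≤ d) {s₁ s₂ : ℝ} (hp : 1 ≤ p)
    (hr₁ : 1 < r) (hr₂ : r < 2) (h1s₁ : 1 ≤ s₁) (hs₁r : s₁ < r) (hrs₂ : r < s₂) (hs₂ : s₂ ≤ 2)
    {R : ℕ → ℝ} (v₁ v₂ : ℕ → ℝ) (hv₁ : ∀ n, 2 ≤ n → 0 < v₁ n) (hv : ∀ n, 2 ≤ n → v₁ n ≤ v₂ n)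
    (h₂ : ∃ C, 0 < C ∧ ∀ n, 2 ≤ n →
      levelSum d p s₂ n (levelCut d n) ^ s₂ * v₁ n ^ (s₂ - r) ≤ C * R n)
    (h : ∃ C, 0 < C ∧ ∀ n, 2 ≤ n →
      (levelSum d p r n (levelCut d n) * (Real.logb 2 (v₂ n / v₁ n) / p + 1)) ^ r ≤ C * R n)
    (h₁ : ∃ C, 0 < C ∧ ∀ n, 2 ≤ n →
      levelSum d p s₁ n (levelCut d n) ^ s₁ * v₂ n ^ (s₁ - r) ≤ C * R n)
    (h₀ : ∃ C, 0 < C ∧ ∀ n : ℕ, 2 ≤ n → ((n : ℝ) ^ (-(p / d))) ^ r ≤ C * R n) :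
    HasDeviationRate d p r R := by
  obtain ⟨C, hC, H⟩ := exists_deviation_bound_of_tail_le hd hp hr₁ hr₂ h1s₁ hs₁r hrs₂ hs₂
  obtain ⟨C₂, hC₂, h₂⟩ := h₂
  obtain ⟨C₁, hC₁, h₁⟩ := h₁
  obtain ⟨C', hC', h⟩ := h
  obtain ⟨C₀, hC₀, h₀⟩ := h₀
  refine ⟨C * (C₂ + C' + C₁ + C₀), by positivity, ?_⟩
  intro Ω _ P _ μ _ X hX hlaw hind htail n hn y hy
  -- `J = levelCut d n` is the least depth with `2 ^ (d J) ≥ n`, so the remainder is at most of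
  -- order `n ^ (-p / d)`.
  refine (H Ω P μ X hX hlaw hind htail n (levelCut d n) (by omega) (one_le_levelCut hd hn) y
    (v₁ n) (v₂ n) hy (hv₁ n hn) (hv n hn)).trans (ENNReal.ofReal_le_ofReal ?_)
  have hdet : ((2 : ℝ) ^ (-(p * levelCut d n))) ^ r ≤ C₀ * R n :=
    (Real.rpow_le_rpow (by positivity) (two_rpow_neg_levelCut_le hd (by linarith) hn)
      (by linarith)).trans (h₀ n hn)
  rw [mul_assoc C (C₂ + C' + C₁ + C₀)]
  gcongr
  linarith [h₂ n hn, h n hn, h₁ n hn]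

lemma hasDeviationRate_of_gt (hd : 1 ≤ d) (hp : 1 ≤ p) (hr₁ : 1 < r) (hr₂ : r < 2)
    (h : d * (r - 1) / r < p) : HasDeviationRate d p r fun n => (n : ℝ) ^ (1 - r) := by
  have hr0 : 0 < r := by linarith
  have hd0 : (0 : ℝ) < d := by exact_mod_cast hd
  -- By continuity an exponent slightly above `r` still has a bounded sum over levels; below `r`,
  -- `s₁ = 1` does.
  obtain ⟨s₂, hs₂, hrs₂, hs₂2⟩ : ∃ s, d * (s - 1) / s < p ∧ r < s ∧ s < 2 := by
    have hcont : ContinuousAt (fun s : ℝ => d * (s - 1) / s) r := by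
      fun_prop (disch := exact hr0.ne')
    have h1 : ∀ᶠ s in nhdsWithin r (Set.Ioi r), d * (s - 1) / s < p :=
      (hcont.eventually_lt continuousAt_const h).filter_mono nhdsWithin_le_nhds
    exact (h1.and (Ioo_mem_nhdsGT hr₂)).exists
  refine hasDeviationRate_of_bound (s₁ := 1) hd hp hr₁ hr₂ le_rfl hr₁ hrs₂ hs₂2.le
    (fun n => n) (fun n => n) (fun n hn => by exact_mod_cast (by omega : 0 < n))
    (fun n _ => le_rfl) (exists_levelSum_le_of_lt (by linarith) hs₂ r) ?_
    (exists_levelSum_le_of_lt le_rfl (by simp; linarith) r) ⟨1, one_pos, fun n hn => ?_⟩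
  · obtain ⟨C, hC, H⟩ := exists_levelSum_le_of_lt hr₁.le h r
    refine ⟨C, hC, fun n hn => ?_⟩
    have hn0 : (n : ℝ) ≠ 0 := by exact_mod_cast (by omega : n ≠ 0)
    simpa [hn0] using H n hn
  · have hn1 : (1 : ℝ) ≤ n := by exact_mod_cast (by omega : 1 ≤ n)
    rw [one_mul, ← Real.rpow_mul (by linarith)]
    refine Real.rpow_le_rpow_of_exponent_le hn1 ?_
    rw [div_lt_iff₀ hr0] at h
    have : r - 1 ≤ p / d * r := by
      rw [div_mul_eq_mul_div, le_div_iff₀ hd0]; linarith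
    linarith

lemma hasDeviationRate_of_lt (hd : 1 ≤ d) (hp : 1 ≤ p) (hr₁ : 1 < r) (hr₂ : r < 2)
    (h : p < d * (r - 1) / r) : HasDeviationRate d p r fun n => (n : ℝ) ^ (-(p / d * r)) := by
  have hr0 : 0 < r := by linarith
  have hd0 : (0 : ℝ) < d := by exact_mod_cast hd
  -- By continuity an exponent slightly below `r` still has a sum dominated by the finest level;
  -- above `r`, `s₂ = 2` does, as `(s - 1) / s` increases.
  obtain ⟨s₁, hs₁, h1s₁, hs₁r⟩ : ∃ s, p < d * (s - 1) / s ∧ 1 < s ∧ s < r := by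
    have hcont : ContinuousAt (fun s : ℝ => d * (s - 1) / s) r := by
      fun_prop (disch := exact hr0.ne')
    have h1 : ∀ᶠ s in nhdsWithin r (Set.Iio r), p < d * (s - 1) / s :=
      (continuousAt_const.eventually_lt hcont h).filter_mono nhdsWithin_le_nhds
    exact (h1.and (Ioo_mem_nhdsLT hr₁)).exists
  have hs₂ : p < d * ((2 : ℝ) - 1) / 2 := by
    refine h.trans ?_
    rw [div_lt_div_iff₀ hr0 (by norm_num)]
    nlinarith
  have hpos : ∀ n : ℕ, 2 ≤ n → 0 < (n : ℝ) ^ (p / d) := fun n hn =>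
    Real.rpow_pos_of_pos (by exact_mod_cast (by omega : 0 < n)) _
  refine hasDeviationRate_of_bound (s₁ := s₁) (s₂ := 2) hd hp hr₁ hr₂ h1s₁.le hs₁r hr₂ le_rfl
    (fun n => (n : ℝ) ^ (p / d)) (fun n => (n : ℝ) ^ (p / d)) hpos
    (fun n _ => le_rfl) (exists_levelSum_le_of_gt hd (by norm_num) hs₂ r) ?_
    (exists_levelSum_le_of_gt hd h1s₁.le hs₁ r) ⟨1, one_pos, fun n hn => ?_⟩
  · obtain ⟨C, hC, H⟩ := exists_levelSum_le_of_gt hd hr₁.le h r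
    refine ⟨C, hC, fun n hn => ?_⟩
    have := H n hn
    rw [sub_self, Real.rpow_zero, mul_one] at this
    rwa [div_self (hpos n hn).ne', Real.logb_one, zero_div, zero_add, mul_one]
  · rw [one_mul, ← Real.rpow_mul (by positivity), neg_mul]

/-- In the critical case `s₂ = 2` has a growing sum over levels and asks for the cut `v₁ = n ^ (p /
d)`, while `s₁ = 1` has a bounded one and asks for `v₂ = n`. Of order `log n` rings at most lie
between, and there `s = r` gives `J` equal levels: two logarithms, raised to the power `r`. -/
lemma hasDeviationRate_of_eq (hd : 1 ≤ d) (hp : 1 ≤ p) (hr₁ : 1 < r) (hr₂ : r < 2)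
    (h : p = d * (r - 1) / r) :
    HasDeviationRate d p r fun n => (n : ℝ) ^ (1 - r) * Real.log n ^ (2 * r) := by
  have hr0 : 0 < r := by linarith
  have hd0 : (0 : ℝ) < d := by exact_mod_cast hd
  have hpd : p / d = (r - 1) / r := by rw [h]; field_simp
  have hpdr : -(p / d * r) = 1 - r := by rw [hpd]; field_simp; ring
  have hpd1 : p / d ≤ 1 := by rw [hpd, div_le_one hr0]; linarith
  have hpd0 : 0 ≤ p / d := by positivity
  have hs₂ : p < d * ((2 : ℝ) - 1) / 2 := by
    rw [h, div_lt_div_iff₀ hr0 (by norm_num)]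
    nlinarith
  have hlog2 : 0 < Real.log 2 := Real.log_pos (by norm_num)
  have hlog : ∀ n : ℕ, 2 ≤ n → Real.log 2 ≤ Real.log n := fun n hn =>
    Real.log_le_log (by norm_num) (by exact_mod_cast hn)
  -- The other terms carry no logarithm; `log n ≥ log 2` lets them be absorbed.
  have absorb : ∀ {f : ℕ → ℝ}, (∃ C, 0 < C ∧ ∀ n : ℕ, 2 ≤ n → f n ≤ C * (n : ℝ) ^ (1 - r)) →
      ∃ C, 0 < C ∧ ∀ n : ℕ, 2 ≤ n → f n ≤ C * ((n : ℝ) ^ (1 - r) * Real.log n ^ (2 * r)) := by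
    rintro f ⟨C, hC, H⟩
    refine ⟨C / Real.log 2 ^ (2 * r), by positivity, fun n hn => (H n hn).trans ?_⟩
    have h1 : Real.log 2 ^ (2 * r) ≤ Real.log n ^ (2 * r) :=
      Real.rpow_le_rpow hlog2.le (hlog n hn) (by positivity)
    have h2 : 0 < Real.log 2 ^ (2 * r) := by positivity
    rw [div_mul_eq_mul_div, le_div_iff₀ h2, ← mul_assoc]
    gcongr
  refine hasDeviationRate_of_bound (s₁ := 1) (s₂ := 2) hd hp hr₁ hr₂ le_rfl hr₁ hr₂ le_rfl
    (fun n => (n : ℝ) ^ (p / d)) (fun n => n)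
    (fun n hn => Real.rpow_pos_of_pos (by exact_mod_cast (by omega : 0 < n)) _) (fun n hn => ?_)
    (absorb ?_) ?_ (absorb (exists_levelSum_le_of_lt le_rfl (by simp; linarith) r))
    (absorb ⟨1, one_pos, fun n hn => ?_⟩)
  · have hn1 : (1 : ℝ) ≤ n := by exact_mod_cast (by omega : 1 ≤ n)
    simpa using Real.rpow_le_rpow_of_exponent_le hn1 hpd1
  · have := exists_levelSum_le_of_gt hd (by norm_num : (1 : ℝ) ≤ 2) hs₂ r
    rwa [hpdr] at this
  · refine ⟨(4 / Real.log 2 ^ 2) ^ r, by positivity, fun n hn => ?_⟩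
    have hn0 : (0 : ℝ) < n := by exact_mod_cast (by omega : 0 < n)
    have hL := one_le_logb_natCast hn
    have hJ := levelCut_le_two_mul_logb hd hn
    have hN0 : 0 ≤ Real.logb 2 (n / (n : ℝ) ^ (p / d)) / p + 1 ∧
        Real.logb 2 (n / (n : ℝ) ^ (p / d)) / p + 1 ≤ 2 * Real.logb 2 n := by
      rw [Real.logb_div hn0.ne' (by positivity), Real.logb_rpow_eq_mul_logb_of_pos hn0]
      have a1 : 0 ≤ Real.logb 2 n - p / d * Real.logb 2 n := by nlinarith
      have a2 := div_le_self a1 hp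
      have a3 : 0 ≤ (Real.logb 2 n - p / d * Real.logb 2 n) / p := by positivity
      have a4 : 0 ≤ p / d * Real.logb 2 n := by positivity
      constructor <;> linarith
    rw [levelSum_of_eq h]
    have hlogn : 0 ≤ Real.log n := hlog2.le.trans (hlog n hn)
    calc _ ≤ ((n : ℝ) ^ ((1 - r) / r) * (2 * Real.logb 2 n) * (2 * Real.logb 2 n)) ^ r := by
          have := hN0.1
          gcongr
          exact hN0.2
      _ = ((4 / Real.log 2 ^ 2) * ((n : ℝ) ^ ((1 - r) / r) * Real.log n ^ (2 : ℝ))) ^ r := by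
          congr 1
          rw [Real.logb, Real.rpow_two]; field_simp; ring
      _ = _ := by
          rw [Real.mul_rpow (by positivity) (by positivity),
            Real.mul_rpow (by positivity) (by positivity), ← Real.rpow_mul hn0.le,
            ← Real.rpow_mul hlogn, div_mul_cancel₀ _ hr0.ne']
  · rw [one_mul, ← Real.rpow_mul (by positivity), neg_mul, hpdr]

end Rates

/-! ### Reduction to a normalised tail -/

section Scaling

variable {d : ℕ} {p : ℝ}

lemma wassersteinPow_map_smul_le {c : ℝ} (hc : 0 < c)
    (ν₁ ν₂ : Measure (EuclideanSpace ℝ (Fin d))) :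
    wassersteinPow p (ν₁.map (c • ·)) (ν₂.map (c • ·)) ≤
      ENNReal.ofReal (c ^ p) * wassersteinPow p ν₁ ν₂ := by
  have hcp : 0 < c ^ p := Real.rpow_pos_of_pos hc p
  have h0 : ENNReal.ofReal (c ^ p) ≠ 0 := by simpa using hcp
  have hm : Measurable fun x : EuclideanSpace ℝ (Fin d) => c • x := measurable_const_smul c
  have hmm := hm.prodMap hm
  rw [mul_comm, ← ENNReal.div_le_iff h0 ENNReal.ofReal_ne_top]
  refine le_iInf₂ fun π hπ => ?_
  obtain ⟨hπ, h1, h2⟩ := hπ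
  rw [ENNReal.div_le_iff h0 ENNReal.ofReal_ne_top]
  refine (iInf₂_le (π.map (Prod.map (c • ·) (c • ·))) ⟨?_, ?_, ?_⟩).trans ?_
  · rw [lintegral_map (by fun_prop) hmm, mul_comm, ← lintegral_const_mul _ (by fun_prop)]
    refine lintegral_mono fun z => le_of_eq ?_
    rw [← ENNReal.ofReal_mul hcp.le, Prod.map_fst, Prod.map_snd, ← smul_sub, norm_smul,
      Real.norm_of_nonneg hc.le, Real.mul_rpow hc.le (norm_nonneg _)]
  · exact Measure.isProbabilityMeasure_map hmm.aemeasurable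
  · rw [Measure.map_map measurable_fst hmm, ← h1, Measure.map_map hm measurable_fst]; rfl
  · rw [Measure.map_map measurable_snd hmm, ← h2, Measure.map_map hm measurable_snd]; rfl

lemma map_smul_empiricalMeasure {Ω : Type*} (X : ℕ → Ω → EuclideanSpace ℝ (Fin d)) (c : ℝ)
    (n : ℕ) (ω : Ω) :
    (empiricalMeasure X n ω).map (c • ·) = empiricalMeasure (fun k ω => c • X k ω) n ω := by
  have hm : Measurable fun x : EuclideanSpace ℝ (Fin d) => c • x := measurable_const_smul c
  unfold empiricalMeasure
  rw [Measure.map_smul, Measure.map_finset_sum hm.aemeasurable]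
  simp_rw [Measure.map_dirac' hm]

/-- Dividing by `c = K ^ (1 / (r p))` normalises the tail. The cost scales by `c ^ p`, so the
threshold becomes `y / c ^ p`, whose power `-r` releases the factor `c ^ (r p) = K`. -/
lemma HasDeviationRate.of_tail_le.{u} {r : ℝ} (hp : 1 ≤ p) (hr : 1 < r) {R : ℕ → ℝ}
    (h : HasDeviationRate.{u} d p r R) :
    ∃ C : ℝ, 0 < C ∧ ∀ (Ω : Type u) [MeasurableSpace Ω] (P : Measure Ω) [IsProbabilityMeasure P]
      (μ : Measure (EuclideanSpace ℝ (Fin d))) [IsProbabilityMeasure μ]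
      (X : ℕ → Ω → EuclideanSpace ℝ (Fin d)),
      (∀ k, Measurable (X k)) → (∀ k, P.map (X k) = μ) → iIndepFun X P →
      ∀ K : ℝ, 0 < K → (∀ t, 0 < t → tail μ t ≤ ENNReal.ofReal (K * t ^ (-(r * p)))) →
      ∀ n : ℕ, 2 ≤ n → ∀ y : ℝ, 0 < y →
        P {ω | ENNReal.ofReal y < wassersteinPow p (empiricalMeasure X n ω) μ} ≤
          ENNReal.ofReal (C * R n * K * y ^ (-r)) := by
  obtain ⟨C, hC, H⟩ := h
  refine ⟨C, hC, ?_⟩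
  intro Ω _ P _ μ _ X hX hlaw hind K hK htail n hn y hy
  have hrp : 0 < r * p := by positivity
  obtain ⟨c, hc⟩ : ∃ c : ℝ, c = K ^ (r * p)⁻¹ := ⟨_, rfl⟩
  have hc0 : 0 < c := by rw [hc]; positivity
  have hcK : c ^ (r * p) = K := by
    rw [hc, ← Real.rpow_mul hK.le, inv_mul_cancel₀ hrp.ne', Real.rpow_one]
  have hcp : 0 < c ^ p := by positivity
  have hm : ∀ a : ℝ, Measurable fun x : EuclideanSpace ℝ (Fin d) => a • x :=
    fun a => measurable_const_smul a
  have hback : ∀ ν : Measure (EuclideanSpace ℝ (Fin d)), (ν.map (c⁻¹ • ·)).map (c • ·) = ν := by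
    intro ν
    rw [Measure.map_map (hm c) (hm c⁻¹)]
    have : ((fun x : EuclideanSpace ℝ (Fin d) => c • x) ∘ fun x => c⁻¹ • x) = id := by
      ext1 x; simp [smul_smul, mul_inv_cancel₀ hc0.ne']
    rw [this, Measure.map_id]
  have hprob : IsProbabilityMeasure (μ.map (c⁻¹ • ·)) :=
    Measure.isProbabilityMeasure_map (hm _).aemeasurable
  have hbound := H Ω P (μ.map (c⁻¹ • ·)) (fun k ω => c⁻¹ • X k ω) (fun k => (hm _).comp (hX k))
    (fun k => by rw [← hlaw k, Measure.map_map (hm _) (hX k)]; rfl)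
    (hind.comp (fun _ x => c⁻¹ • x) fun _ => hm _) ?_ n hn (y / c ^ p) (by positivity)
  · refine (measure_mono fun ω hω => ?_).trans (hbound.trans (le_of_eq ?_))
    · simp only [Set.mem_ofPred_eq] at hω ⊢
      have hW := wassersteinPow_map_smul_le (p := p) hc0
        ((empiricalMeasure X n ω).map (c⁻¹ • ·)) (μ.map (c⁻¹ • ·))
      rw [hback, hback, map_smul_empiricalMeasure] at hW
      by_contra hcon
      refine absurd (hω.trans_le (hW.trans (mul_le_mul' le_rfl (not_lt.1 hcon)))) ?_
      rw [← ENNReal.ofReal_mul hcp.le, mul_div_cancel₀ _ hcp.ne']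
      exact lt_irrefl _
    · congr 1
      rw [Real.div_rpow hy.le hcp.le, ← Real.rpow_mul hc0.le, ← hcK, mul_assoc (C * R n)]
      congr 1
      rw [show p * -r = -(r * p) by ring, Real.rpow_neg hc0.le, div_inv_eq_mul, mul_comm]
  · intro t ht
    have hset : MeasurableSet {y : EuclideanSpace ℝ (Fin d) | t < ‖WithLp.ofLp y‖} :=
      measurableSet_lt measurable_const (by fun_prop)
    have : tail (μ.map (c⁻¹ • ·)) t = tail μ (c * t) := by
      unfold tail
      rw [Measure.map_apply (hm _) hset]
      congr 1; ext x
      simp only [Set.mem_preimage, Set.mem_ofPred_eq, WithLp.ofLp_smul, norm_smul, norm_inv,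
        Real.norm_of_nonneg hc0.le]
      rw [inv_mul_eq_div, lt_div_iff₀ hc0, mul_comm]
    rw [this]
    refine (htail _ (by positivity)).trans (ENNReal.ofReal_le_ofReal (le_of_eq ?_))
    rw [Real.mul_rpow hc0.le ht.le, Real.rpow_neg hc0.le, hcK, ← mul_assoc,
      mul_inv_cancel₀ hK.ne', one_mul]

end Scaling

/-! ### From weak moments to the limit superior -/

lemma tail_le_of_weakMoment_le {d : ℕ} {q K : ℝ} {μ : Measure (EuclideanSpace ℝ (Fin d))}
    (h : weakMoment q μ ≤ ENNReal.ofReal K) {t : ℝ} (ht : 0 < t) :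
    tail μ t ≤ ENNReal.ofReal (K * t ^ (-q)) := by
  have h1 : ENNReal.ofReal (t ^ q) * tail μ t ≤ ENNReal.ofReal K :=
    (le_iSup₂ (f := fun (t : ℝ) (_ : 0 < t) => ENNReal.ofReal (t ^ q) * tail μ t) t ht).trans h
  have htq : 0 < t ^ q := Real.rpow_pos_of_pos ht q
  rw [mul_comm, ← ENNReal.le_div_iff_mul_le (by left; simpa using htq)
    (by left; exact ENNReal.ofReal_ne_top), ← ENNReal.ofReal_div_of_pos htq] at h1
  rwa [Real.rpow_neg ht.le, ← div_eq_mul_inv]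

lemma HasDeviationRate.limsup_le.{u} {d : ℕ} {p r : ℝ} (hp : 1 ≤ p) (hr : 1 < r) {R : ℕ → ℝ}
    (h : HasDeviationRate.{u} d p r R) :
    ∃ C : ℝ, 0 < C ∧ ∀ (Ω : Type u) [MeasurableSpace Ω] (P : Measure Ω) [IsProbabilityMeasure P]
      (μ : Measure (EuclideanSpace ℝ (Fin d))) [IsProbabilityMeasure μ]
      (X : ℕ → Ω → EuclideanSpace ℝ (Fin d)),
      (∀ k, Measurable (X k)) → (∀ k, P.map (X k) = μ) → iIndepFun X P →
      weakMoment (r * p) μ < ∞ → ∀ α x : ℝ, 0 < x → ∀ a : ℕ → ℝ,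
      (∀ n : ℕ, 2 ≤ n → 0 ≤ a n ∧ a n * R n * ((n : ℝ) ^ (1 - α)) ^ r = 1) →
      limsup (fun n : ℕ ↦ ENNReal.ofReal (a n) * deviationProb P X μ p x α n) atTop ≤
        ENNReal.ofReal C * (weakMoment (r * p) μ / ENNReal.ofReal (x ^ r)) := by
  obtain ⟨C, hC, H⟩ := h.of_tail_le hp hr
  refine ⟨C, hC, ?_⟩
  intro Ω _ P _ μ _ X hX hlaw hind hmom α x hx a ha
  obtain ⟨K, hK⟩ : ∃ K : ℝ, K = (weakMoment (r * p) μ).toReal := ⟨_, rfl⟩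
  have hK0 : 0 ≤ K := hK ▸ ENNReal.toReal_nonneg
  have hwK : weakMoment (r * p) μ = ENNReal.ofReal K := by
    rw [hK, ENNReal.ofReal_toReal hmom.ne]
  refine limsup_le_of_le (by isBoundedDefault) ?_
  filter_upwards [eventually_ge_atTop 2] with n hn
  obtain ⟨ha0, ha1⟩ := ha n hn
  have hn0 : (0 : ℝ) < n := by exact_mod_cast (by omega : 0 < n)
  have hy : 0 < x / (n : ℝ) ^ (1 - α) := by positivity
  have hxr : 0 < x ^ r := by positivity
  -- The dilation needs a positive constant while the weak moment may vanish; hence `K + ε`, and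
  -- then `ε → 0`.
  have hε : ∀ ε : ℝ, 0 < ε → ENNReal.ofReal (a n) * deviationProb P X μ p x α n ≤
      ENNReal.ofReal (C * ((K + ε) / x ^ r)) := by
    intro ε hε
    have h1 := H Ω P μ X hX hlaw hind (K + ε) (by positivity)
      (fun t ht => tail_le_of_weakMoment_le
        (hwK.trans_le (ENNReal.ofReal_le_ofReal (by linarith))) ht) n hn _ hy
    refine (mul_le_mul' le_rfl h1).trans (le_of_eq ?_)
    rw [← ENNReal.ofReal_mul ha0]
    congr 1
    rw [Real.rpow_neg hy.le, Real.div_rpow hx.le (by positivity), inv_div]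
    linear_combination (C * (K + ε) / x ^ r) * ha1
  rw [hwK, ← ENNReal.ofReal_div_of_pos hxr, ← ENNReal.ofReal_mul hC.le]
  have hcont : Continuous fun ε : ℝ => ENNReal.ofReal (C * ((K + ε) / x ^ r)) :=
    ENNReal.continuous_ofReal.comp (by fun_prop)
  have hlim := (hcont.tendsto 0).mono_left (nhdsWithin_le_nhds (s := Set.Ioi 0))
  rw [add_zero] at hlim
  exact ge_of_tendsto hlim (eventually_mem_nhdsWithin.mono hε)

theorem corollary3p1 (d : ℕ) (hd : 1 ≤ d) (p r : ℝ) (hp : 1 ≤ p) (hr₁ : 1 < r) (hr₂ : r < 2) :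
    ∃ C : ℝ, 0 < C ∧
      ∀ (Ω : Type*) [MeasurableSpace Ω] (P : Measure Ω) [IsProbabilityMeasure P]
        (μ : Measure (EuclideanSpace ℝ (Fin d))) [IsProbabilityMeasure μ]
        (X : ℕ → Ω → EuclideanSpace ℝ (Fin d)),
        (∀ k, Measurable (X k)) → (∀ k, P.map (X k) = μ) → iIndepFun X P →
        weakMoment (r * p) μ < ∞ →
        ∀ α x : ℝ, 0 < x →
          (d * (r - 1) / r < p → 1 / r ≤ α → α ≤ 1 →
            limsup (fun n : ℕ ↦ ENNReal.ofReal ((n : ℝ) ^ (α * r - 1)) *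
                deviationProb P X μ p x α n) atTop
              ≤ ENNReal.ofReal C * (weakMoment (r * p) μ / ENNReal.ofReal (x ^ r))) ∧
          (p = d * (r - 1) / r → 1 / r < α → α ≤ 1 →
            limsup (fun n : ℕ ↦
                ENNReal.ofReal ((n : ℝ) ^ (α * r - 1) / (Real.log n) ^ (2 * r)) *
                  deviationProb P X μ p x α n) atTop
              ≤ ENNReal.ofReal C * (weakMoment (r * p) μ / ENNReal.ofReal (x ^ r))) ∧
          (p < d * (r - 1) / r → ((d : ℝ) - p) / d ≤ α → α ≤ 1 →
            limsup (fun n : ℕ ↦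
                ENNReal.ofReal ((n : ℝ) ^ ((p * r - (1 - α) * r * d) / d)) *
                  deviationProb P X μ p x α n) atTop
              ≤ ENNReal.ofReal C * (weakMoment (r * p) μ / ENNReal.ofReal (x ^ r))) := by
  have hd0 : (0 : ℝ) < d := by exact_mod_cast hd
  -- The regime depends on `d`, `p` and `r` only, so `C` may be chosen after it; the other two
  -- claims are then vacuous.
  rcases lt_trichotomy p (d * (r - 1) / r) with h | h | h
  · obtain ⟨C, hC, H⟩ := (hasDeviationRate_of_lt hd hp hr₁ hr₂ h).limsup_le hp hr₁
    refine ⟨C, hC, fun Ω _ P _ μ _ X hX hlaw hind hmom α x hx =>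
      ⟨fun h' => absurd h h'.asymm, fun h' => absurd h' h.ne, fun _ _ _ => ?_⟩⟩
    refine H Ω P μ X hX hlaw hind hmom α x hx _ fun n hn => ⟨by positivity, ?_⟩
    have hn0 : (0 : ℝ) < n := by exact_mod_cast (by omega : 0 < n)
    rw [← Real.rpow_mul hn0.le, ← Real.rpow_add hn0, ← Real.rpow_add hn0]
    convert Real.rpow_zero (n : ℝ) using 2
    field_simp; ring
  · obtain ⟨C, hC, H⟩ := (hasDeviationRate_of_eq hd hp hr₁ hr₂ h).limsup_le hp hr₁
    refine ⟨C, hC, fun Ω _ P _ μ _ X hX hlaw hind hmom α x hx =>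
      ⟨fun h' => absurd h h'.ne', fun _ _ _ => ?_, fun h' => absurd h h'.ne⟩⟩
    refine H Ω P μ X hX hlaw hind hmom α x hx _ fun n hn => ?_
    have hn0 : (0 : ℝ) < n := by exact_mod_cast (by omega : 0 < n)
    have hlog : 0 < Real.log n := Real.log_pos (by exact_mod_cast (by omega : 1 < n))
    have hlogr : 0 < Real.log n ^ (2 * r) := by positivity
    refine ⟨by positivity, ?_⟩
    have e : (n : ℝ) ^ (α * r - 1) * (n : ℝ) ^ (1 - r) * ((n : ℝ) ^ (1 - α)) ^ r = 1 := by
      rw [← Real.rpow_mul hn0.le, ← Real.rpow_add hn0, ← Real.rpow_add hn0]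
      convert Real.rpow_zero (n : ℝ) using 2
      ring
    refine Eq.trans ?_ e
    field_simp
  · obtain ⟨C, hC, H⟩ := (hasDeviationRate_of_gt hd hp hr₁ hr₂ h).limsup_le hp hr₁
    refine ⟨C, hC, fun Ω _ P _ μ _ X hX hlaw hind hmom α x hx =>
      ⟨fun _ _ _ => ?_, fun h' => absurd h' h.ne', fun h' => absurd h h'.asymm⟩⟩
    refine H Ω P μ X hX hlaw hind hmom α x hx _ fun n hn => ⟨by positivity, ?_⟩
    have hn0 : (0 : ℝ) < n := by exact_mod_cast (by omega : 0 < n)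
    rw [← Real.rpow_mul hn0.le, ← Real.rpow_add hn0, ← Real.rpow_add hn0]
    convert Real.rpow_zero (n : ℝ) using 2
    ring
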